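/- For $\nu\in\mathbb{R}$ and $z>0$ let $K_\nu(z)=\int_0^\infty e^{-z\cosh t}\cosh(\nu t)\,dt$ be the modified Bessel function of the third kind. For a parameter $\theta=(\lambda,\omega,\mu,\sigma,\beta)$ with $\lambda,\mu,\beta\in\mathbb{R}$ and $\omega,\sigma>0$, the univariate generalized hyperbolic density is $$f(x\mid\theta)=\left[\frac{\omega+(x-\mu)^2/\sigma^2}{\omega+\beta^2/\sigma^2}\right]^{(\lambda-1/2)/2}\frac{K_{\lambda-1/2}\Big(\sqrt{[\omega+\beta^2/\sigma^2]\,[\omega+(x-\mu)^2/\sigma^2]}\Big)}{\sqrt{2\pi\sigma^2}\,K_\lambda(\omega)\,\exp\{-(x-\mu)\beta/\sigma^2\}},\qquad x\in\mathbb{R}.$$ Finite mixtures of univariate generalized hyperbolic distributions are identifiable: let $\theta_1,\dots,\theta_G$ be pairwise distinct parameters and let $\theta_1',\dots,\theta_{G'}'$ be pairwise distinct parameters, and let $\pi_1,\dots,\pi_G>0$ and $\pi_1',\dots,\pi_{G'}'>0$ satisfy $\sum_{g=1}^{G}\pi_g=\sum_{g=1}^{G'}\pi_g'=1$. If $$\sum_{g=1}^{G}\pi_g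 f(x\mid\theta_g)=\sum_{g=1}^{G'}\pi_g' f(x\mid\theta_g')\qquad\text{for all }x\in\mathbb{R},$$ then $G=G'$ and there is a permutation $\tau$ of $\{1,\dots,G\}$ such that $\pi_g=\pi_{\tau(g)}'$ and $\theta_g=\theta_{\tau(g)}'$ for all $g$. -/

import Mathlib

/-- The modified Bessel function of the third kind `K_ν(z)` (also called the modified Bessel
function of the second kind, or Macdonald function), for a real index `ν` and a real argument
`z > 0`, through its standard integral representation
`K_ν(z) = ∫_0^∞ exp (-z cosh t) cosh (ν t) dt`. It is only used at `z > 0`, where the integral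
converges absolutely. -/
noncomputable def besselK (ν z : ℝ) : ℝ :=
  ∫ t in Set.Ioi (0 : ℝ), Real.exp (-(z * Real.cosh t)) * Real.cosh (ν * t)

/-- The parameters of a univariate generalized hyperbolic distribution: index `lam`, concentration
`ω > 0`, location `μ`, scale `σ > 0` and skewness `β`. -/
@[ext]
structure GHParam where
  lam : ℝ
  ω : ℝ
  μ : ℝ
  σ : ℝ
  β : ℝ
  ω_pos : 0 < ω
  σ_pos : 0 < σ

/-- The density of the univariate generalized hyperbolic distribution with parameters `θ`. -/
noncomputable def ghDensity (θ : GHParam) (x : ℝ) : ℝ :=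
  ((θ.ω + (x - θ.μ) ^ 2 / θ.σ ^ 2) / (θ.ω + θ.β ^ 2 / θ.σ ^ 2)) ^ ((θ.lam - 1 / 2) / 2) *
    (besselK (θ.lam - 1 / 2)
        (Real.sqrt ((θ.ω + θ.β ^ 2 / θ.σ ^ 2) * (θ.ω + (x - θ.μ) ^ 2 / θ.σ ^ 2))) /
      (Real.sqrt (2 * Real.pi * θ.σ ^ 2) * besselK θ.lam θ.ω *
        Real.exp (-((x - θ.μ) * θ.β / θ.σ ^ 2))))

/-- Finite mixtures from the family of densities `f θ`, `θ : Θ`, are identifiable: two mixtures with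
positive weights summing to one and with pairwise distinct component parameters that agree
everywhere have the same number of components, and up to a relabelling of the components they have
the same weights and the same parameters. Equivalently, distinct mixing distributions with finite
support correspond to distinct mixtures. -/
def FiniteMixturesIdentifiable {Θ X : Type*} (f : Θ → X → ℝ) : Prop :=
  ∀ (G G' : ℕ) (w : Fin G → ℝ) (w' : Fin G' → ℝ) (θ : Fin G → Θ) (θ' : Fin G' → Θ),
    (∀ g, 0 < w g) → (∀ g, 0 < w' g) →
    ∑ g, w g = 1 → ∑ g, w' g = 1 →
    Function.Injective θ → Function.Injective θ' →
    (∀ x, ∑ g, w g * f (θ g) x = ∑ g, w' g * f (θ' g) x) →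
    ∃ e : Fin G ≃ Fin G', ∀ g, w g = w' (e g) ∧ θ g = θ' (e g)

/-!
Identifiability of finite mixtures follows from linear independence of the densities. Write
`ν = λ - 1/2`, `α = √(ω + β²/σ²) / σ`, `b = β/σ²`, `δ = σ √ω` and `r(x) = √((x - μ)² + δ²)`. Up to a
positive constant the density is `e^{bx} r^ν K_ν(α r)`, and `(λ, α, b, μ, δ)` determines the
parameter (`exists_ghDensity_eq`, `GHParam.eq_of_shape`). It decays like `e^{-(α-b)x}` at `+∞` and
like `e^{-(α+b)|x|}` at `-∞`, up to powers of `|x|`.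

Distinct parameters can share a decay rate, and then the leading terms may cancel, so comparing
leading terms at `±∞` is not enough. The key point is that a combination of
densities with the *same* rate `p` at `+∞` cannot decay faster than that rate without vanishing
identically (`HasTailRate.eq_zero`). Indeed `√x e^x K_ν(x) = Ψ_ν(√x)` with `Ψ_ν` holomorphic in the
right half-plane and of linear growth in `1 ≤ Re ρ` (`besselPsi_sqrt`, `exists_norm_besselPsi_le`),
so the combination times `e^{ps}` continues with polynomial growth to the exterior of a parabola
around the negative real axis. In the coordinate `ζ` with `s = (ζ + m)²` this exterior is a half-plane on which
exponential decay in `s` is superexponential, and the Phragmén–Lindelöf principle applies. Hence in a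
vanishing combination the terms with each given rate at `+∞` cancel among themselves
(`sum_filter_rate_eq_zero`). By reflection `x ↦ -x` the same holds at `-∞`, so one may assume that
all terms have the same `α` and `b` (`sum_filter_rates_eq_zero`).

For fixed `α` and `b`, divide by `e^{bx}` and take Fourier transforms: the density is a Gaussian
mixture over a generalized inverse Gaussian variance, so its transform at frequency `t` is a multiple
of `e^{iμt} (δ/T)^λ K_λ(δT)` with `T = √(α² + t²)` (`fourier_gigIntegral`). This behaves like
`e^{iμt} e^{-δT} T^{-λ-1/2}`, so the terms with lexicographically smallest `(δ, λ)` dominate, and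
those differ only in the frequency `μ` of an oscillation (`coeff_eq_zero_of_tendsto_exp_sum`).
-/

open MeasureTheory Filter Topology

/-! ### Generalized inverse Gaussian integrals and the Bessel function -/

/-- The integral `∫_0^∞ v^{a-1} exp (-A/v - B v) dv`, the normalising constant of the generalized
inverse Gaussian distribution. -/
noncomputable def gigIntegral (a A B : ℝ) : ℝ :=
  ∫ v in Set.Ioi (0 : ℝ), v ^ (a - 1) * Real.exp (-(A / v) - B * v)

lemma gig_integrableOn (a : ℝ) {A B : ℝ} (hA : 0 < A) (hB : 0 < B) :
    IntegrableOn (fun v : ℝ => v ^ (a - 1) * Real.exp (-(A / v) - B * v)) (Set.Ioi 0) := by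
  obtain ⟨n, hn⟩ := exists_nat_gt (-a)
  have h1 : IntegrableOn (fun v : ℝ => (n.factorial / A ^ n) *
      (v ^ (a - 1 + n) * Real.exp (-B * v ^ (1 : ℝ)))) (Set.Ioi 0) :=
    (integrableOn_rpow_mul_exp_neg_mul_rpow (by linarith) one_pos hB).const_mul _
  -- Near `0` the factor `e^{-A/v} ≤ n! (v/A)^n` makes up for a negative exponent.
  refine Integrable.mono' h1 ?_ ?_
  · refine (ContinuousOn.aestronglyMeasurable ?_ measurableSet_Ioi)
    intro v hv
    have hv' : v ≠ 0 := (Set.mem_Ioi.1 hv).ne'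
    have : ContinuousAt (fun v : ℝ => v ^ (a - 1) * Real.exp (-(A / v) - B * v)) v := by
      have := Real.continuousAt_rpow_const v (a - 1) (Or.inl hv')
      fun_prop (disch := assumption)
    exact this.continuousWithinAt
  · refine (ae_restrict_iff' measurableSet_Ioi).2 (ae_of_all _ fun v hv => ?_)
    have hv : 0 < v := hv
    rw [Real.norm_of_nonneg (by positivity), Real.rpow_add hv, Real.rpow_natCast, Real.rpow_one,
      sub_eq_add_neg (-(A / v)), Real.exp_add]
    have h2 : Real.exp (-(A / v)) ≤ n.factorial / A ^ n * v ^ n := by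
      have h3 := Real.pow_div_factorial_le_exp (A / v) (by positivity) n
      rw [Real.exp_neg, inv_le_comm₀ (Real.exp_pos _) (by positivity)]
      refine le_trans (le_of_eq ?_) h3
      rw [div_pow]
      field_simp
    have h4 : 0 ≤ v ^ (a - 1) * Real.exp (-(B * v)) := by positivity
    calc v ^ (a - 1) * (Real.exp (-(A / v)) * Real.exp (-(B * v)))
        = v ^ (a - 1) * Real.exp (-(B * v)) * Real.exp (-(A / v)) := by ring
      _ ≤ v ^ (a - 1) * Real.exp (-(B * v)) * (n.factorial / A ^ n * v ^ n) := by gcongr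
      _ = _ := by rw [neg_mul]; ring

lemma gigIntegral_pos (a : ℝ) {A B : ℝ} (hA : 0 < A) (hB : 0 < B) : 0 < gigIntegral a A B := by
  unfold gigIntegral
  rw [setIntegral_pos_iff_support_of_nonneg_ae _ (gig_integrableOn a hA hB)]
  · have : Function.support (fun v : ℝ => v ^ (a - 1) * Real.exp (-(A / v) - B * v)) ∩ Set.Ioi 0
        = Set.Ioi 0 := by
      refine Set.inter_eq_right.2 fun v hv => ?_
      have hv : 0 < v := hv
      exact (by positivity : 0 < v ^ (a - 1) * Real.exp (-(A / v) - B * v)).ne'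
    rw [this]
    simp
  · refine (ae_restrict_iff' measurableSet_Ioi).2 (ae_of_all _ fun v hv => ?_)
    have hv : 0 < v := hv
    simp only [Pi.zero_apply]
    positivity

/-- The substitution `v = √(A/B) e^t` turns the generalized inverse Gaussian integral into the
integral defining the Bessel function. -/
lemma gigIntegral_eq_besselK (a : ℝ) {A B : ℝ} (hA : 0 < A) (hB : 0 < B) :
    gigIntegral a A B = 2 * (Real.sqrt (A / B)) ^ a * besselK a (2 * Real.sqrt (A * B)) := by
  set c := Real.sqrt (A / B) with hc
  set z := 2 * Real.sqrt (A * B) with hz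
  have hc0 : 0 < c := Real.sqrt_pos.2 (by positivity)
  have himg : (fun t : ℝ => c * Real.exp t) '' Set.univ = Set.Ioi 0 := by
    ext v
    simp only [Set.image_univ, Set.mem_range, Set.mem_Ioi]
    constructor
    · rintro ⟨t, rfl⟩; positivity
    · intro hv
      exact ⟨Real.log (v / c), by rw [Real.exp_log (by positivity)]; field_simp⟩
  have hder : ∀ t ∈ (Set.univ : Set ℝ), HasDerivWithinAt (fun t : ℝ => c * Real.exp t)
      (c * Real.exp t) Set.univ t := fun t _ =>
    ((Real.hasDerivAt_exp t).const_mul c).hasDerivWithinAt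
  have hinj : Set.InjOn (fun t : ℝ => c * Real.exp t) Set.univ := by
    intro s _ t _ h
    simpa [hc0.ne'] using h
  have hAc : A / c = Real.sqrt (A * B) := by
    rw [hc, Real.sqrt_div hA.le, Real.sqrt_mul hA.le]
    have h1 := Real.sq_sqrt hA.le
    have h2 := Real.sqrt_pos.2 hA
    have h3 := Real.sqrt_pos.2 hB
    field_simp
    nlinarith
  have hBc : B * c = Real.sqrt (A * B) := by
    rw [hc, Real.sqrt_div hA.le, Real.sqrt_mul hA.le]
    have h1 := Real.sq_sqrt hB.le
    have h3 := Real.sqrt_pos.2 hB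
    field_simp
    nlinarith
  have hfun : (fun t : ℝ => |c * Real.exp t| • ((c * Real.exp t) ^ (a - 1) *
      Real.exp (-(A / (c * Real.exp t)) - B * (c * Real.exp t)))) =
      fun t => c ^ a * (Real.exp (a * t) * Real.exp (-(z * Real.cosh t))) := by
    funext t
    have h0 : 0 < c * Real.exp t := by positivity
    rw [abs_of_pos h0, smul_eq_mul, ← mul_assoc, Real.rpow_sub h0, Real.rpow_one,
      mul_div_cancel₀ _ h0.ne', Real.mul_rpow hc0.le (Real.exp_pos t).le, ← Real.exp_mul,
      ← div_div, hAc, ← mul_assoc B, hBc, hz, Real.cosh_eq, mul_assoc, mul_comm t a]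
    congr 3
    rw [div_eq_mul_inv, ← Real.exp_neg]
    ring
  have hint := gig_integrableOn a hA hB
  rw [← himg, integrableOn_image_iff_integrableOn_abs_deriv_smul MeasurableSet.univ hder hinj,
    hfun, integrableOn_univ] at hint
  unfold gigIntegral
  rw [← himg, integral_image_eq_integral_abs_deriv_smul MeasurableSet.univ hder hinj, hfun,
    setIntegral_univ, integral_const_mul]
  have hint' : Integrable (fun t : ℝ => Real.exp (a * t) * Real.exp (-(z * Real.cosh t))) := by
    have h := hint.const_mul (c ^ a)⁻¹
    refine h.congr (ae_of_all _ fun t => ?_)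
    have : c ^ a ≠ 0 := (Real.rpow_pos_of_pos hc0 a).ne'
    simp only
    field_simp
  rw [← integral_add_compl measurableSet_Iic hint', Set.compl_Iic]
  have hneg := integral_comp_neg_Iic (0 : ℝ)
    (fun t : ℝ => Real.exp (-(a * t)) * Real.exp (-(z * Real.cosh t)))
  simp only [mul_neg, neg_neg, Real.cosh_neg, neg_zero] at hneg
  have hintneg : IntegrableOn (fun t : ℝ => Real.exp (-(a * t)) * Real.exp (-(z * Real.cosh t)))
      (Set.Ioi 0) := by
    have h := hint'.comp_neg
    simp only [mul_neg, Real.cosh_neg] at h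
    exact h.integrableOn
  rw [hneg, ← integral_add hintneg hint'.integrableOn]
  unfold besselK
  rw [mul_comm 2 (c ^ a), mul_assoc, ← integral_const_mul 2]
  congr 1
  refine integral_congr_ae (ae_of_all _ fun t => ?_)
  simp only [Real.cosh_eq (a * t)]
  ring

lemma besselK_pos (ν : ℝ) {z : ℝ} (hz : 0 < z) : 0 < besselK ν z := by
  have h1 := gigIntegral_eq_besselK ν (half_pos hz) (half_pos hz)
  have h2 := gigIntegral_pos ν (half_pos hz) (half_pos hz)
  rw [Real.sqrt_mul_self (half_pos hz).le, div_self (half_pos hz).ne', Real.sqrt_one,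
    Real.one_rpow, mul_div_cancel₀ z two_ne_zero] at h1
  linarith

/-! ### Square roots and the integrand of the continued Bessel function -/

/-- The principal square root. -/
noncomputable def csqrt (w : ℂ) : ℂ := Complex.exp (Complex.log w / 2)

lemma csqrt_sq {w : ℂ} (hw : w ≠ 0) : csqrt w ^ 2 = w := by
  rw [csqrt, ← Complex.exp_nat_mul]
  push_cast
  rw [mul_div_cancel₀ _ two_ne_zero, Complex.exp_log hw]

lemma csqrt_re_pos {w : ℂ} (hw : w ∈ Complex.slitPlane) : 0 < (csqrt w).re := by
  rw [csqrt, Complex.exp_re]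
  refine mul_pos (Real.exp_pos _) (Real.cos_pos_of_mem_Ioo ?_)
  have h1 := Complex.neg_pi_lt_arg w
  have h2 := (Complex.mem_slitPlane_iff_arg.1 hw).1
  have h3 := (Complex.arg_le_pi w).lt_of_ne h2
  have h4 : (Complex.log w / 2).im = Complex.arg w / 2 := by
    simp [Complex.log_im]
  rw [h4]
  constructor <;> linarith

lemma csqrt_ofReal {x : ℝ} (hx : 0 < x) : csqrt x = (Real.sqrt x : ℝ) := by
  rw [csqrt, ← Complex.ofReal_log hx.le, Real.sqrt_eq_rpow, Real.rpow_def_of_pos hx]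
  push_cast
  congr 1
  ring

lemma csqrt_differentiableAt {w : ℂ} (hw : w ∈ Complex.slitPlane) :
    DifferentiableAt ℂ csqrt w := by
  unfold csqrt
  exact ((Complex.differentiableAt_log hw).div_const 2).cexp

lemma norm_csqrt_sq {w : ℂ} (hw : w ≠ 0) : ‖csqrt w‖ ^ 2 = ‖w‖ := by
  rw [← norm_pow, csqrt_sq hw]

lemma one_add_sq_mem_slitPlane {y : ℂ} (hy : 0 < y.re) : 1 + y ^ 2 ∈ Complex.slitPlane := by
  rw [Complex.mem_slitPlane_iff]
  by_cases h : y.im = 0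
  · left
    simp [pow_two, h]
    positivity
  · right
    have : (1 + y ^ 2).im = 2 * (y.re * y.im) := by
      simp [pow_two]
      ring
    rw [this]
    exact mul_ne_zero two_ne_zero (mul_ne_zero hy.ne' h)

/-- The function `y + √(1 + y²)`, that is, `exp (arsinh y)`. -/
noncomputable def expArsinh (y : ℂ) : ℂ := y + csqrt (1 + y ^ 2)

lemma expArsinh_re_pos {y : ℂ} (hy : 0 < y.re) : 0 < (expArsinh y).re := by
  have := csqrt_re_pos (one_add_sq_mem_slitPlane hy)
  simp only [expArsinh, Complex.add_re]
  linarith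

lemma expArsinh_mem_slitPlane {y : ℂ} (hy : 0 < y.re) : expArsinh y ∈ Complex.slitPlane :=
  Or.inl (expArsinh_re_pos hy)

lemma norm_csqrt_one_add_sq_le {y : ℂ} (hy : 0 < y.re) : ‖csqrt (1 + y ^ 2)‖ ≤ 1 + ‖y‖ := by
  have h1 := norm_csqrt_sq (Complex.slitPlane_ne_zero (one_add_sq_mem_slitPlane hy))
  have h2 : ‖1 + y ^ 2‖ ≤ 1 + ‖y‖ ^ 2 := by
    refine (norm_add_le _ _).trans ?_
    simp
  refine abs_le_of_sq_le_sq' (a := ‖csqrt (1 + y ^ 2)‖) ?_ (by positivity) |>.2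
  nlinarith [norm_nonneg y]

lemma norm_expArsinh_le {y : ℂ} (hy : 0 < y.re) : ‖expArsinh y‖ ≤ 1 + 2 * ‖y‖ := by
  have := norm_csqrt_one_add_sq_le hy
  have h := norm_add_le y (csqrt (1 + y ^ 2))
  unfold expArsinh
  linarith

lemma norm_expArsinh_inv_le {y : ℂ} (hy : 0 < y.re) : ‖(expArsinh y)⁻¹‖ ≤ 1 + 2 * ‖y‖ := by
  have h0 := Complex.slitPlane_ne_zero (expArsinh_mem_slitPlane hy)
  have h1 : (expArsinh y)⁻¹ = csqrt (1 + y ^ 2) - y := by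
    refine inv_eq_of_mul_eq_one_right ?_
    have := csqrt_sq (Complex.slitPlane_ne_zero (one_add_sq_mem_slitPlane hy))
    unfold expArsinh
    linear_combination this
  have := norm_csqrt_one_add_sq_le hy
  have h := norm_sub_le (csqrt (1 + y ^ 2)) y
  rw [h1]
  linarith

lemma norm_expArsinh_cpow_le {y : ℂ} (hy : 0 < y.re) {c : ℝ} {N : ℕ} (hN : |c| ≤ N) :
    ‖expArsinh y ^ (c : ℂ)‖ ≤ (1 + 2 * ‖y‖) ^ N := by
  have h0 := Complex.slitPlane_ne_zero (expArsinh_mem_slitPlane hy)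
  have hpos : 0 < ‖expArsinh y‖ := norm_pos_iff.2 h0
  have hE : 1 ≤ 1 + 2 * ‖y‖ := by linarith [norm_nonneg y]
  rw [Complex.norm_cpow_real]
  have key : ‖expArsinh y‖ ^ c ≤ (1 + 2 * ‖y‖) ^ |c| := by
    rcases le_total 0 c with hc | hc
    · rw [abs_of_nonneg hc]
      exact Real.rpow_le_rpow hpos.le (norm_expArsinh_le hy) hc
    · rw [abs_of_nonpos hc]
      have : ‖expArsinh y‖ ^ c = ‖(expArsinh y)⁻¹‖ ^ (-c) := by
        rw [norm_inv, Real.inv_rpow hpos.le, ← Real.rpow_neg hpos.le, neg_neg]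
      rw [this]
      exact Real.rpow_le_rpow (norm_nonneg _) (norm_expArsinh_inv_le hy) (by linarith)
  refine key.trans ?_
  rw [← Real.rpow_natCast]
  exact Real.rpow_le_rpow_of_exponent_le hE hN

/-- The function `cosh (2 ν τ) / cosh τ` in the variable `y = sinh τ`, extended to complex `y` in
the right half-plane. -/
noncomputable def besselProfile (ν : ℝ) (y : ℂ) : ℂ :=
  (expArsinh y ^ ((2 * ν : ℝ) : ℂ) + expArsinh y ^ ((-(2 * ν) : ℝ) : ℂ)) /
    (2 * csqrt (1 + y ^ 2))

lemma csqrt_ne_zero (w : ℂ) : csqrt w ≠ 0 := Complex.exp_ne_zero _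

lemma besselProfile_differentiableAt_of_mem (ν : ℝ) {y : ℂ}
    (h1 : 1 + y ^ 2 ∈ Complex.slitPlane) (h2 : expArsinh y ∈ Complex.slitPlane) :
    DifferentiableAt ℂ (besselProfile ν) y := by
  have h3 : DifferentiableAt ℂ (fun y : ℂ => csqrt (1 + y ^ 2)) y :=
    DifferentiableAt.fun_comp' (g := csqrt) (f := fun y : ℂ => 1 + y ^ 2) y
      (csqrt_differentiableAt h1) (by fun_prop)
  have h4 : DifferentiableAt ℂ expArsinh y := differentiableAt_id.add h3
  have h5 : ∀ c : ℂ, DifferentiableAt ℂ (fun y => expArsinh y ^ c) y := fun c =>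
    h4.cpow (differentiableAt_const c) h2
  exact ((h5 _).add (h5 _)).div (h3.const_mul 2) (mul_ne_zero two_ne_zero (csqrt_ne_zero _))

lemma besselProfile_differentiableAt (ν : ℝ) {y : ℂ} (hy : 0 < y.re) :
    DifferentiableAt ℂ (besselProfile ν) y :=
  besselProfile_differentiableAt_of_mem ν (one_add_sq_mem_slitPlane hy)
    (expArsinh_mem_slitPlane hy)

lemma besselProfile_sinh (ν τ : ℝ) :
    besselProfile ν (Real.sinh τ : ℝ) = (Real.cosh (2 * ν * τ) / Real.cosh τ : ℝ) := by
  have h1 : csqrt (1 + ((Real.sinh τ : ℝ) : ℂ) ^ 2) = (Real.cosh τ : ℝ) := by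
    have : 1 + ((Real.sinh τ : ℝ) : ℂ) ^ 2 = ((Real.cosh τ ^ 2 : ℝ) : ℂ) := by
      rw [Real.cosh_sq]; push_cast; ring
    rw [this, csqrt_ofReal (by positivity), Real.sqrt_sq (Real.cosh_pos τ).le]
  have h2 : expArsinh (Real.sinh τ : ℝ) = (Real.exp τ : ℝ) := by
    rw [expArsinh, h1, ← Complex.ofReal_add, Real.sinh_add_cosh]
  rw [besselProfile, h1, h2, ← Complex.ofReal_cpow (Real.exp_pos _).le,
    ← Complex.ofReal_cpow (Real.exp_pos _).le, ← Real.exp_mul, ← Real.exp_mul,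
    Real.cosh_eq (2 * ν * τ)]
  push_cast
  have : ((Real.cosh τ : ℝ) : ℂ) ≠ 0 := by exact_mod_cast (Real.cosh_pos τ).ne'
  push_cast at this
  field_simp

lemma norm_add_re_le_two_mul (w : ℂ) : ‖w‖ + w.re ≤ 2 * ‖w‖ := by
  have := Complex.re_le_norm w
  linarith

lemma re_sq_le_norm_sq_add (ρ : ℂ) {τ : ℝ} (hτ : 0 ≤ τ) : ρ.re ^ 2 ≤ ‖ρ ^ 2 + τ‖ := by
  have h1 := norm_add_re_le_two_mul (ρ ^ 2 + τ)
  have h2 : ‖ρ ^ 2‖ ≤ ‖ρ ^ 2 + τ‖ + τ := by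
    have := norm_sub_le (ρ ^ 2 + τ) (τ : ℂ)
    simpa [abs_of_nonneg hτ] using this
  have h3 : ‖ρ ^ 2‖ = ρ.re ^ 2 + ρ.im ^ 2 := by
    rw [norm_pow, Complex.sq_norm, Complex.normSq_apply]; ring
  have h4 : (ρ ^ 2 + τ).re = ρ.re ^ 2 - ρ.im ^ 2 + τ := by
    simp [pow_two]
  linarith

lemma div_sqrt_two_mul_re_pos {ρ : ℂ} (hρ : 0 < ρ.re) {u : ℝ} (hu : 0 < u) :
    0 < ((u : ℂ) / ((Real.sqrt 2 : ℝ) * ρ)).re := by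
  have h : (u : ℂ) / ((Real.sqrt 2 : ℝ) * ρ) = ((u / Real.sqrt 2 : ℝ) : ℂ) * ρ⁻¹ := by
    push_cast
    rw [div_mul_eq_div_div, div_eq_mul_inv]
  rw [h, Complex.re_ofReal_mul, Complex.inv_re]
  have : 0 < Complex.normSq ρ := Complex.normSq_pos.2 (by rintro rfl; simp at hρ)
  positivity

/-- A bound valid for complex `ρ`: the inverse of `y + √(1+y²)` is `√(1+y²) - y`, so all powers of
`y + √(1+y²)` grow polynomially, and `1 + y²` stays away from `0` because `ρ²` stays away from the
negative real axis. -/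
lemma norm_besselProfile_le (ν : ℝ) {N : ℕ} (hN : |2 * ν| ≤ N) {ρ : ℂ} (hρ : 0 < ρ.re) {u : ℝ}
    (hu : 0 < u) : ‖besselProfile ν ((u : ℂ) / ((Real.sqrt 2 : ℝ) * ρ))‖ ≤
      (1 + 2 * (u / ‖ρ‖)) ^ N * (‖ρ‖ / ρ.re) := by
  set y := (u : ℂ) / ((Real.sqrt 2 : ℝ) * ρ) with hy
  have hy0 : 0 < y.re := div_sqrt_two_mul_re_pos hρ hu
  have hρ0 : ρ ≠ 0 := by rintro rfl; simp at hρ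
  have hρn : 0 < ‖ρ‖ := norm_pos_iff.2 hρ0
  have hs : (1 : ℝ) ≤ Real.sqrt 2 := Real.one_le_sqrt.2 (by norm_num)
  have hyn : ‖y‖ ≤ u / ‖ρ‖ := by
    rw [hy, norm_div, norm_mul, Complex.norm_real, Complex.norm_real, Real.norm_of_nonneg hu.le,
      Real.norm_of_nonneg (by positivity)]
    gcongr
    nlinarith
  have hsq : 1 + y ^ 2 = (ρ ^ 2 + (u ^ 2 / 2 : ℝ)) / ρ ^ 2 := by
    have h2 : ((Real.sqrt 2 : ℝ) : ℂ) ^ 2 = 2 := by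
      rw [← Complex.ofReal_pow, Real.sq_sqrt (by norm_num)]; norm_num
    rw [hy, div_pow, mul_pow, h2]
    push_cast
    field_simp
  have hden : ρ.re / ‖ρ‖ ≤ ‖csqrt (1 + y ^ 2)‖ := by
    have h1 := norm_csqrt_sq (Complex.slitPlane_ne_zero (one_add_sq_mem_slitPlane hy0))
    refine abs_le_of_sq_le_sq' ?_ (norm_nonneg _) |>.2
    rw [h1, hsq, norm_div, div_pow, norm_pow ρ]
    gcongr
    exact re_sq_le_norm_sq_add ρ (by positivity)
  have hnum : ∀ c : ℝ, |c| ≤ N → ‖expArsinh y ^ (c : ℂ)‖ ≤ (1 + 2 * (u / ‖ρ‖)) ^ N := by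
    intro c hc
    refine (norm_expArsinh_cpow_le hy0 hc).trans ?_
    gcongr
  rw [besselProfile, norm_div, norm_mul, Complex.norm_ofNat]
  have hd0 : 0 < ρ.re / ‖ρ‖ := by positivity
  calc _ ≤ (2 * (1 + 2 * (u / ‖ρ‖)) ^ N) / (2 * (ρ.re / ‖ρ‖)) := by
        gcongr
        refine (norm_add_le _ _).trans ?_
        rw [two_mul ((1 + 2 * (u / ‖ρ‖)) ^ N)]
        exact add_le_add (hnum _ hN) (hnum _ (by rwa [abs_neg]))
    _ = _ := by field_simp

/-! ### Holomorphic continuation of the Bessel function -/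

/-- Holomorphy of a parameter integral whose integrand is holomorphic in the parameter and locally
dominated; Cauchy's estimate supplies the domination of the derivative. -/
lemma differentiableAt_integral_of_dominated {m : Measure ℝ} {F : ℂ → ℝ → ℂ} {z₀ : ℂ} {ε : ℝ}
    (hε : 0 < ε) {g : ℝ → ℝ} (hg : Integrable g m)
    (hmeas : ∀ z ∈ Metric.ball z₀ ε, AEStronglyMeasurable (F z) m)
    (hdiff : ∀ᵐ u ∂m, ∀ z ∈ Metric.ball z₀ ε, DifferentiableAt ℂ (fun z => F z u) z)
    (hbound : ∀ᵐ u ∂m, ∀ z ∈ Metric.ball z₀ ε, ‖F z u‖ ≤ g u) :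
    DifferentiableAt ℂ (fun z => ∫ u, F z u ∂m) z₀ := by
  have hz₀ : z₀ ∈ Metric.ball z₀ ε := Metric.mem_ball_self hε
  have hsub : ∀ z ∈ Metric.ball z₀ (ε / 2), Metric.closedBall z (ε / 4) ⊆ Metric.ball z₀ ε := by
    intro z hz w hw
    rw [Metric.mem_ball] at *
    rw [Metric.mem_closedBall] at hw
    linarith [dist_triangle w z z₀]
  have hderiv : ∀ᵐ u ∂m, ∀ z ∈ Metric.ball z₀ (ε / 2),
      ‖deriv (fun z => F z u) z‖ ≤ g u / (ε / 4) := by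
    filter_upwards [hdiff, hbound] with u hd hb z hz
    refine Complex.norm_deriv_le_of_forall_mem_sphere_norm_le (by positivity) ?_ ?_
    · refine DifferentiableOn.diffContOnCl ?_
      rw [closure_ball z (by positivity)]
      exact fun w hw => (hd w (hsub z hz hw)).differentiableWithinAt
    · exact fun w hw => hb w (hsub z hz (Metric.sphere_subset_closedBall hw))
  have hmeas' : AEStronglyMeasurable (fun u => deriv (fun z => F z u) z₀) m := by
    set h : ℕ → ℂ := fun n => ((ε / 2 / (n + 1) : ℝ) : ℂ) with hh
    have hpos : ∀ n : ℕ, 0 < ε / 2 / ((n : ℝ) + 1) := fun n => by positivity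
    have hball : ∀ n, z₀ + h n ∈ Metric.ball z₀ ε := by
      intro n
      rw [Metric.mem_ball, dist_eq_norm, add_sub_cancel_left, hh, Complex.norm_real,
        Real.norm_of_nonneg (hpos n).le]
      have : ε / 2 / ((n : ℝ) + 1) ≤ ε / 2 := div_le_self (by positivity) (by
        have : (0 : ℝ) ≤ n := by positivity
        linarith)
      linarith
    have hlim : Tendsto h atTop (𝓝[≠] 0) := by
      refine tendsto_nhdsWithin_iff.2 ⟨?_, Eventually.of_forall fun n => ?_⟩
      · have h1 : Tendsto (fun n : ℕ => ε / 2 / ((n : ℝ) + 1)) atTop (𝓝 0) :=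
          tendsto_const_nhds.div_atTop (tendsto_atTop_add_const_right _ _
            tendsto_natCast_atTop_atTop)
        have h2 := (Complex.continuous_ofReal.tendsto 0).comp h1
        rwa [Complex.ofReal_zero] at h2
      · exact Complex.ofReal_ne_zero.2 (hpos n).ne'
    refine aestronglyMeasurable_of_tendsto_ae (u := atTop)
      (f := fun n u => (h n)⁻¹ • (F (z₀ + h n) u - F z₀ u))
      (fun n => ((hmeas _ (hball n)).sub (hmeas _ hz₀)).const_smul (h n)⁻¹) ?_
    filter_upwards [hdiff] with u hd
    exact ((hasDerivAt_iff_tendsto_slope_zero.1 (hd z₀ hz₀).hasDerivAt).comp hlim)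
  refine (hasDerivAt_integral_of_dominated_loc_of_deriv_le (s := Metric.ball z₀ (ε / 2))
    (F' := fun z u => deriv (fun z => F z u) z) (bound := fun u => g u / (ε / 4))
    (Metric.ball_mem_nhds _ (by positivity)) ?_ ?_ hmeas' hderiv (hg.div_const _) ?_
    ).2.differentiableAt
  · filter_upwards [Metric.ball_mem_nhds z₀ hε] with z hz using hmeas z hz
  · refine Integrable.mono' hg (hmeas _ hz₀) ?_
    filter_upwards [hbound] with u hb using hb _ hz₀
  · filter_upwards [hdiff] with u hd z hz
    exact (hd z (Metric.ball_subset_ball (by linarith) hz)).hasDerivAt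

lemma integrableOn_exp_neg_sq_mul_pow (N : ℕ) {κ : ℝ} (hκ : 0 ≤ κ) :
    IntegrableOn (fun u : ℝ => Real.exp (-u ^ 2) * (1 + κ * u) ^ N) (Set.Ioi 0) := by
  have h1 : ∀ n : ℕ, IntegrableOn (fun u : ℝ => u ^ n * Real.exp (-u ^ 2)) (Set.Ioi 0) := by
    intro n
    have h := (integrable_rpow_mul_exp_neg_mul_sq one_pos
      (s := (n : ℝ)) (by linarith [(Nat.cast_nonneg n : (0 : ℝ) ≤ n)])).integrableOn
      (s := Set.Ioi 0)
    simpa using h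
  have h2 : IntegrableOn (fun u : ℝ => 2 ^ (N - 1) * (u ^ 0 * Real.exp (-u ^ 2) +
      κ ^ N * (u ^ N * Real.exp (-u ^ 2)))) (Set.Ioi 0) :=
    ((h1 0).add ((h1 N).const_mul _)).const_mul _
  refine Integrable.mono' h2 (by fun_prop) ?_
  refine (ae_restrict_iff' measurableSet_Ioi).2 (ae_of_all _ fun u hu => ?_)
  have hu : 0 < u := hu
  rw [Real.norm_of_nonneg (by positivity)]
  have h3 := add_pow_le (zero_le_one' ℝ) (by positivity : 0 ≤ κ * u) N
  rw [one_pow, mul_pow] at h3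
  have h4 := mul_le_mul_of_nonneg_left h3 (Real.exp_pos (-u ^ 2)).le
  refine h4.trans (le_of_eq ?_)
  ring

/-- The holomorphic function `Ψ_ν` on the right half-plane with `√x e^x K_ν(x) = Ψ_ν(√x)`
for `x > 0`. -/
noncomputable def besselPsi (ν : ℝ) (ρ : ℂ) : ℂ :=
  (Real.sqrt 2 : ℝ) * ∫ u in Set.Ioi (0 : ℝ),
    (Real.exp (-u ^ 2) : ℝ) * besselProfile ν ((u : ℂ) / ((Real.sqrt 2 : ℝ) * ρ))

lemma besselPsi_integrand_measurable (ν : ℝ) {ρ : ℂ} (hρ : 0 < ρ.re) :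
    AEStronglyMeasurable (fun u : ℝ => (Real.exp (-u ^ 2) : ℝ) *
      besselProfile ν ((u : ℂ) / ((Real.sqrt 2 : ℝ) * ρ))) (volume.restrict (Set.Ioi 0)) := by
  refine ContinuousOn.aestronglyMeasurable (fun u hu => ContinuousAt.continuousWithinAt ?_)
    measurableSet_Ioi
  have h1 := (besselProfile_differentiableAt ν (div_sqrt_two_mul_re_pos hρ hu)).continuousAt
  have h2 : ContinuousAt (fun u : ℝ => (u : ℂ) / ((Real.sqrt 2 : ℝ) * ρ)) u := by fun_prop
  exact ContinuousAt.mul (by fun_prop) (ContinuousAt.comp' h1 h2)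

lemma norm_besselPsi_integrand_le (ν : ℝ) {N : ℕ} (hN : |2 * ν| ≤ N) {ρ : ℂ} {e R : ℝ}
    (he : 0 < e) (hρ : e ≤ ρ.re) (hR : ‖ρ‖ ≤ R) {u : ℝ} (hu : 0 < u) :
    ‖(Real.exp (-u ^ 2) : ℝ) * besselProfile ν ((u : ℂ) / ((Real.sqrt 2 : ℝ) * ρ))‖ ≤
      Real.exp (-u ^ 2) * (1 + 2 / e * u) ^ N * (R / e) := by
  have hρn : e ≤ ‖ρ‖ := hρ.trans (Complex.re_le_norm ρ)
  have h := norm_besselProfile_le ν hN (he.trans_le hρ) hu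
  rw [norm_mul, Complex.norm_real, Real.norm_of_nonneg (Real.exp_pos _).le, mul_assoc]
  gcongr
  refine h.trans ?_
  have h1 : 2 * (u / ‖ρ‖) ≤ 2 / e * u := by
    rw [div_mul_eq_mul_div, ← mul_div_assoc]
    gcongr
  have h2 : 0 < ρ.re := he.trans_le hρ
  gcongr
  exact (norm_nonneg _).trans hR

lemma besselPsi_differentiableAt (ν : ℝ) {ρ : ℂ} (hρ : 0 < ρ.re) :
    DifferentiableAt ℂ (besselPsi ν) ρ := by
  obtain ⟨N, hN⟩ := exists_nat_ge |2 * ν|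
  have hball : ∀ z ∈ Metric.ball ρ (ρ.re / 2), ρ.re / 2 ≤ z.re ∧ ‖z‖ ≤ 2 * ‖ρ‖ := by
    intro z hz
    rw [Metric.mem_ball, dist_eq_norm] at hz
    have h1 := (Complex.abs_re_le_norm (z - ρ)).trans hz.le
    rw [Complex.sub_re] at h1
    have h2 := norm_le_norm_add_norm_sub' z ρ
    have h3 := Complex.re_le_norm ρ
    constructor <;> linarith [neg_abs_le (z.re - ρ.re)]
  unfold besselPsi
  refine DifferentiableAt.const_mul ?_ _
  refine differentiableAt_integral_of_dominated (ε := ρ.re / 2) (by positivity)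
    (g := fun u => Real.exp (-u ^ 2) * (1 + 2 / (ρ.re / 2) * u) ^ N * (2 * ‖ρ‖ / (ρ.re / 2)))
    ((integrableOn_exp_neg_sq_mul_pow N (by positivity)).mul_const _) ?_ ?_ ?_
  · intro z hz
    exact besselPsi_integrand_measurable ν (by linarith [(hball z hz).1])
  · refine (ae_restrict_iff' measurableSet_Ioi).2 (ae_of_all _ fun u hu z hz => ?_)
    have hz0 : 0 < z.re := by linarith [(hball z hz).1]
    have hzne : z ≠ 0 := by rintro rfl; simp at hz0
    have hs : ((Real.sqrt 2 : ℝ) : ℂ) ≠ 0 := by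
      exact_mod_cast (Real.sqrt_pos.2 two_pos).ne'
    have h1 := besselProfile_differentiableAt ν (div_sqrt_two_mul_re_pos hz0 hu)
    refine DifferentiableAt.const_mul ?_ _
    exact DifferentiableAt.fun_comp' (g := besselProfile ν) z h1
      ((differentiableAt_const _).div (differentiableAt_id.const_mul _) (mul_ne_zero hs hzne))
  · refine (ae_restrict_iff' measurableSet_Ioi).2 (ae_of_all _ fun u hu z hz => ?_)
    exact norm_besselPsi_integrand_le ν hN (by positivity) (hball z hz).1 (hball z hz).2 hu

lemma exists_norm_besselPsi_le (ν : ℝ) : ∃ C : ℝ, 0 ≤ C ∧ ∀ ρ : ℂ, 1 ≤ ρ.re →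
    ‖besselPsi ν ρ‖ ≤ C * ‖ρ‖ := by
  obtain ⟨N, hN⟩ := exists_nat_ge |2 * ν|
  refine ⟨Real.sqrt 2 * ∫ u in Set.Ioi (0 : ℝ), Real.exp (-u ^ 2) * (1 + 2 / 1 * u) ^ N,
    mul_nonneg (Real.sqrt_nonneg _) (setIntegral_nonneg measurableSet_Ioi fun u hu => ?_),
    fun ρ hρ => ?_⟩
  · have hu : 0 < u := hu
    positivity
  · rw [besselPsi, norm_mul, Complex.norm_real, Real.norm_of_nonneg (Real.sqrt_nonneg _),
      mul_assoc, ← integral_mul_const]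
    gcongr
    refine norm_integral_le_of_norm_le
      ((integrableOn_exp_neg_sq_mul_pow N (by norm_num)).mul_const _) ?_
    refine (ae_restrict_iff' measurableSet_Ioi).2 (ae_of_all _ fun u hu => ?_)
    simpa using norm_besselPsi_integrand_le ν hN one_pos hρ le_rfl hu

/-- The substitution `u = √(2x) sinh (t/2)` in the integral for `K_ν(x)`. -/
lemma besselPsi_sqrt (ν : ℝ) {x : ℝ} (hx : 0 < x) :
    besselPsi ν (Real.sqrt x : ℝ) = (Real.sqrt x * Real.exp x * besselK ν x : ℝ) := by
  set c := Real.sqrt 2 * Real.sqrt x with hc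
  have hc0 : 0 < c := by positivity
  have hc2 : c ^ 2 = 2 * x := by
    rw [hc, mul_pow, Real.sq_sqrt (by norm_num), Real.sq_sqrt hx.le]
  have himg : (fun t : ℝ => c * Real.sinh (t / 2)) '' Set.Ioi 0 = Set.Ioi 0 := by
    ext v
    simp only [Set.mem_image, Set.mem_Ioi]
    constructor
    · rintro ⟨t, ht, rfl⟩
      exact mul_pos hc0 (Real.sinh_pos_iff.2 (by linarith))
    · intro hv
      refine ⟨2 * Real.arsinh (v / c), ?_, ?_⟩
      · have := Real.arsinh_pos_iff.2 (div_pos hv hc0)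
        linarith
      · rw [mul_div_cancel_left₀ _ two_ne_zero, Real.sinh_arsinh]
        field_simp
  have hder : ∀ t ∈ Set.Ioi (0 : ℝ), HasDerivWithinAt (fun t : ℝ => c * Real.sinh (t / 2))
      (c * (Real.cosh (t / 2) * (1 / 2))) (Set.Ioi 0) t := fun t _ =>
    ((((hasDerivAt_id t).div_const 2).sinh).const_mul c).hasDerivWithinAt
  have hinj : Set.InjOn (fun t : ℝ => c * Real.sinh (t / 2)) (Set.Ioi 0) := by
    intro s _ t _ h
    have h := Real.sinh_injective (mul_left_cancel₀ hc0.ne' h)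
    linarith
  rw [besselPsi]
  rw [← himg, integral_image_eq_integral_abs_deriv_smul measurableSet_Ioi hder hinj]
  have hfun : ∀ t ∈ Set.Ioi (0 : ℝ), |c * (Real.cosh (t / 2) * (1 / 2))| •
      (((Real.exp (-(c * Real.sinh (t / 2)) ^ 2) : ℝ) : ℂ) * besselProfile ν
        (((c * Real.sinh (t / 2) : ℝ) : ℂ) / ((Real.sqrt 2 : ℝ) * (Real.sqrt x : ℝ)))) =
      ((c / 2 * Real.exp x * (Real.exp (-(x * Real.cosh t)) * Real.cosh (ν * t)) : ℝ) : ℂ) := by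
    intro t ht
    have ht : 0 < t := ht
    have hch : 0 < Real.cosh (t / 2) := Real.cosh_pos _
    have h1 : ((c * Real.sinh (t / 2) : ℝ) : ℂ) / ((Real.sqrt 2 : ℝ) * (Real.sqrt x : ℝ)) =
        (Real.sinh (t / 2) : ℝ) := by
      rw [← Complex.ofReal_mul, ← Complex.ofReal_div, ← hc, mul_div_cancel_left₀ _ hc0.ne']
    have h2 : Real.cosh t = 1 + 2 * Real.sinh (t / 2) ^ 2 := by
      have h3 := Real.cosh_two_mul (t / 2)
      have h4 := Real.cosh_sq (t / 2)
      rw [mul_div_cancel₀ t two_ne_zero] at h3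
      linarith
    rw [h1, besselProfile_sinh ν (t / 2), abs_of_pos (by positivity), Complex.real_smul,
      ← Complex.ofReal_mul, ← Complex.ofReal_mul]
    congr 1
    have h5 : Real.exp (-(c * Real.sinh (t / 2)) ^ 2) =
        Real.exp x * Real.exp (-(x * Real.cosh t)) := by
      rw [← Real.exp_add, mul_pow, hc2, h2]
      congr 1
      ring
    have h6 : 2 * ν * (t / 2) = ν * t := by ring
    rw [h5, h6]
    field_simp
  rw [setIntegral_congr_fun measurableSet_Ioi hfun, integral_complex_ofReal, integral_const_mul,
    ← Complex.ofReal_mul]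
  congr 1
  change _ * (_ * besselK ν x) = _
  have h7 : Real.sqrt 2 * c = 2 * Real.sqrt x := by
    rw [hc, ← mul_assoc, Real.mul_self_sqrt (by norm_num)]
  linear_combination (Real.exp x * besselK ν x / 2) * h7

lemma besselPsi_tendsto (ν : ℝ) :
    Tendsto (fun ρ : ℝ => besselPsi ν ρ) atTop (𝓝 (Real.sqrt (Real.pi / 2) : ℝ)) := by
  obtain ⟨N, hN⟩ := exists_nat_ge |2 * ν|
  have hs : (0 : ℝ) < Real.sqrt 2 := by positivity
  have hval : ((Real.sqrt (Real.pi / 2) : ℝ) : ℂ) = (Real.sqrt 2 : ℝ) *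
      ∫ u in Set.Ioi (0 : ℝ), ((Real.exp (-u ^ 2) : ℝ) : ℂ) * 1 := by
    have h1 := integral_gaussian_Ioi 1
    simp only [neg_mul, one_mul, div_one] at h1
    simp only [mul_one]
    rw [integral_complex_ofReal, h1, ← Complex.ofReal_mul]
    congr 1
    rw [Real.sqrt_div Real.pi_pos.le]
    have := Real.sq_sqrt (zero_le_two (α := ℝ))
    field_simp
    rw [this]
  rw [hval]
  unfold besselPsi
  refine Tendsto.const_mul _ ?_
  refine tendsto_integral_filter_of_dominated_convergence
    (fun u => Real.exp (-u ^ 2) * (1 + 2 / 1 * u) ^ N) ?_ ?_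
    (integrableOn_exp_neg_sq_mul_pow N (by norm_num)) ?_
  · filter_upwards [eventually_gt_atTop 0] with ρ hρ
    exact besselPsi_integrand_measurable ν (by simpa using hρ)
  · filter_upwards [eventually_ge_atTop 1] with ρ hρ
    refine (ae_restrict_iff' measurableSet_Ioi).2 (ae_of_all _ fun u hu => ?_)
    have hu : 0 < u := hu
    have hρ0 : 0 < ρ := by linarith
    have h := norm_besselProfile_le ν hN (ρ := (ρ : ℂ)) (by simpa using hρ0) hu
    rw [Complex.norm_real, Real.norm_of_nonneg hρ0.le, Complex.ofReal_re, div_self hρ0.ne',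
      mul_one] at h
    rw [norm_mul, Complex.norm_real, Real.norm_of_nonneg (Real.exp_pos _).le]
    gcongr
    refine h.trans ?_
    have : u / ρ ≤ u := div_le_self hu.le hρ
    gcongr
    norm_num
  · refine ae_of_all _ fun u => Tendsto.const_mul _ ?_
    have hone : csqrt 1 = 1 := by simp [csqrt]
    have h0 : besselProfile ν 0 = 1 := by
      simp [besselProfile, expArsinh, hone]
    have hcont : ContinuousAt (besselProfile ν) 0 :=
      (besselProfile_differentiableAt_of_mem ν (by simp) (by simp [expArsinh, hone])).continuousAt
    rw [ContinuousAt, h0] at hcont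
    refine hcont.comp ?_
    have h1 : Tendsto (fun ρ : ℝ => u / (Real.sqrt 2 * ρ)) atTop (𝓝 0) :=
      tendsto_const_nhds.div_atTop (tendsto_id.const_mul_atTop hs)
    have h2 := (Complex.continuous_ofReal.tendsto 0).comp h1
    rw [Complex.ofReal_zero] at h2
    refine h2.congr fun ρ => ?_
    simp

/-! ### Tail rates and the Phragmén–Lindelöf principle -/

/-- `2 (Re √w)²`, a `2`-Lipschitz measure of the position of `w` relative to the negative real axis:
for `M > 0` the sets `M ≤ parabolicHeight w` are closed exteriors of parabolas around that axis. -/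
noncomputable def parabolicHeight (w : ℂ) : ℝ := ‖w‖ + w.re

lemma parabolicHeight_sq (a : ℂ) : parabolicHeight (a ^ 2) = 2 * a.re ^ 2 := by
  have h3 : ‖a ^ 2‖ = a.re ^ 2 + a.im ^ 2 := by
    rw [norm_pow, Complex.sq_norm, Complex.normSq_apply]; ring
  have h4 : (a ^ 2).re = a.re ^ 2 - a.im ^ 2 := by simp [pow_two]
  rw [parabolicHeight, h3, h4]
  ring

lemma mem_slitPlane_of_parabolicHeight_pos {w : ℂ} (h : 0 < parabolicHeight w) :
    w ∈ Complex.slitPlane := by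
  rw [Complex.mem_slitPlane_iff]
  by_contra! hc
  have h1 : w = (w.re : ℂ) := by
    apply Complex.ext <;> simp [hc.2]
  rw [parabolicHeight, h1, Complex.norm_real, Real.norm_of_nonpos hc.1, Complex.ofReal_re] at h
  linarith

lemma parabolicHeight_le_add (w w' : ℂ) :
    parabolicHeight w ≤ parabolicHeight w' + 2 * ‖w - w'‖ := by
  have h1 := norm_le_norm_add_norm_sub' w w'
  have h2 := Complex.re_le_norm (w - w')
  rw [Complex.sub_re] at h2
  unfold parabolicHeight
  linarith

lemma parabolicHeight_ofReal_mul {c : ℝ} (hc : 0 ≤ c) (w : ℂ) :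
    parabolicHeight (c * w) = c * parabolicHeight w := by
  rw [parabolicHeight, norm_mul, Complex.norm_real, Real.norm_of_nonneg hc, Complex.re_ofReal_mul,
    parabolicHeight]
  ring

lemma one_le_csqrt_re {w : ℂ} (hw : 2 ≤ parabolicHeight w) : 1 ≤ (csqrt w).re := by
  have h1 := mem_slitPlane_of_parabolicHeight_pos (by linarith : 0 < parabolicHeight w)
  have h2 := csqrt_re_pos h1
  rw [← csqrt_sq (Complex.slitPlane_ne_zero h1), parabolicHeight_sq] at hw
  nlinarith

/-- `H` is analytic along the real axis and extends holomorphically to the exterior of a parabola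
around the negative real axis, where `e^{p s} H(s)` has polynomial growth. -/
structure HasTailRate (p : ℝ) (H : ℂ → ℂ) : Prop where
  analyticAt : ∀ x : ℝ, AnalyticAt ℂ H x
  tail : ∃ (M C : ℝ) (N : ℕ), ∀ s : ℂ, M ≤ parabolicHeight s →
    DifferentiableAt ℂ H s ∧ ‖Complex.exp (p * s) * H s‖ ≤ C * (1 + ‖s‖) ^ N

lemma HasTailRate.zero (p : ℝ) : HasTailRate p (fun _ => 0) :=
  ⟨fun _ => analyticAt_const, 0, 0, 0, fun s _ => ⟨differentiableAt_const _, by simp⟩⟩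

lemma HasTailRate.const_mul {p : ℝ} {H : ℂ → ℂ} (h : HasTailRate p H) (c : ℂ) :
    HasTailRate p (fun s => c * H s) := by
  obtain ⟨M, C, N, ht⟩ := h.tail
  refine ⟨fun x => analyticAt_const.mul (h.analyticAt x), M, ‖c‖ * C, N, fun s hs => ?_⟩
  obtain ⟨h1, h2⟩ := ht s hs
  refine ⟨h1.const_mul c, ?_⟩
  rw [mul_left_comm, norm_mul, mul_assoc]
  gcongr

lemma HasTailRate.add {p : ℝ} {H H' : ℂ → ℂ} (h : HasTailRate p H) (h' : HasTailRate p H') :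
    HasTailRate p (fun s => H s + H' s) := by
  obtain ⟨M, C, N, ht⟩ := h.tail
  obtain ⟨M', C', N', ht'⟩ := h'.tail
  refine ⟨fun x => (h.analyticAt x).add (h'.analyticAt x), max M M', |C| + |C'|, N + N',
    fun s hs => ?_⟩
  obtain ⟨h1, h2⟩ := ht s ((le_max_left _ _).trans hs)
  obtain ⟨h1', h2'⟩ := ht' s ((le_max_right _ _).trans hs)
  refine ⟨h1.add h1', ?_⟩
  have hone : 1 ≤ 1 + ‖s‖ := by linarith [norm_nonneg s]
  rw [mul_add, add_mul]
  refine (norm_add_le _ _).trans (add_le_add (h2.trans ?_) (h2'.trans ?_))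
  · calc C * (1 + ‖s‖) ^ N ≤ |C| * (1 + ‖s‖) ^ N := by gcongr; exact le_abs_self C
      _ ≤ _ := by gcongr; all_goals simp
  · calc C' * (1 + ‖s‖) ^ N' ≤ |C'| * (1 + ‖s‖) ^ N' := by gcongr; exact le_abs_self C'
      _ ≤ _ := by gcongr; all_goals simp

lemma HasTailRate.sum {ι : Type*} {p : ℝ} {E : ι → ℂ → ℂ} (t : Finset ι)
    (h : ∀ i ∈ t, HasTailRate p (E i)) : HasTailRate p (fun s => ∑ i ∈ t, E i s) := by
  classical
  induction t using Finset.induction_on with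
  | empty => simpa using HasTailRate.zero p
  | insert a t ha ih =>
    simp only [Finset.sum_insert ha]
    exact (h a (Finset.mem_insert_self _ _)).add
      (ih fun i hi => h i (Finset.mem_insert_of_mem hi))

/-- A function `H` of tail rate `p` for which `e^{px} H(x)` decays at `+∞` faster than every
`e^{-c√x}` vanishes on the real axis. In the coordinate `ζ` with `s = (ζ + m)²` the exterior of a parabola is a half-plane, and
exponential decay in `s` is superexponential decay in `ζ`, which the Phragmén–Lindelöf principle
excludes. -/
lemma HasTailRate.eq_zero {p : ℝ} {H : ℂ → ℂ} (h : HasTailRate p H)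
    (hdecay : ∀ c : ℝ, Tendsto (fun x : ℝ => Real.exp (c * Real.sqrt x) *
      ‖Complex.exp (p * x) * H x‖) atTop (𝓝 0)) (x : ℝ) : H x = 0 := by
  obtain ⟨M, C, N, ht⟩ := h.tail
  set m : ℝ := max M 1 with hm
  have hm1 : 1 ≤ m := le_max_right _ _
  have hmM : M ≤ m := le_max_left _ _
  -- The division by a power of `(ζ + m)²` turns polynomial growth into boundedness.
  set f : ℂ → ℂ := fun ζ => Complex.exp (p * (ζ + m) ^ 2) * H ((ζ + m) ^ 2) /
    ((ζ + m) ^ 2) ^ N with hf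
  have hre : ∀ ζ : ℂ, 0 ≤ ζ.re → m ≤ (ζ + m).re := by
    intro ζ hζ
    simp
    exact hζ
  have hheight : ∀ ζ : ℂ, 0 ≤ ζ.re → M ≤ parabolicHeight ((ζ + m) ^ 2) := by
    intro ζ hζ
    rw [parabolicHeight_sq]
    nlinarith [hre ζ hζ]
  have hnorm : ∀ ζ : ℂ, 0 ≤ ζ.re → 1 ≤ ‖(ζ + m) ^ 2‖ := by
    intro ζ hζ
    rw [norm_pow]
    exact one_le_pow₀ (hm1.trans ((hre ζ hζ).trans (Complex.re_le_norm _)))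
  have hbound : ∀ ζ : ℂ, 0 ≤ ζ.re → ‖f ζ‖ ≤ |C| * 2 ^ N := by
    intro ζ hζ
    have h1 := (ht _ (hheight ζ hζ)).2
    have h2 := hnorm ζ hζ
    simp only [hf]
    rw [norm_div, norm_pow _ N, div_le_iff₀ (by positivity), mul_assoc, ← mul_pow]
    refine h1.trans ?_
    gcongr
    · exact le_abs_self C
    · linarith
  have hdiff : ∀ ζ : ℂ, 0 ≤ ζ.re → DifferentiableAt ℂ f ζ := by
    intro ζ hζ
    have h1 : DifferentiableAt ℂ (fun ζ : ℂ => H ((ζ + m) ^ 2)) ζ :=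
      DifferentiableAt.fun_comp' (g := H) ζ (ht _ (hheight ζ hζ)).1 (by fun_prop)
    have h2 : ((ζ + m) ^ 2) ^ N ≠ 0 := by
      have : (ζ + m) ^ 2 ≠ 0 := norm_pos_iff.1 (one_pos.trans_le (hnorm ζ hζ))
      exact pow_ne_zero _ this
    exact (DifferentiableAt.mul (by fun_prop) h1).div (by fun_prop) h2
  have hzero := PhragmenLindelof.eq_zero_on_right_half_plane_of_superexponential_decay (f := f)
    (DifferentiableOn.diffContOnCl (by
      rw [Complex.closure_setOfPred_lt_re]
      exact fun ζ hζ => (hdiff ζ hζ).differentiableWithinAt))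
    ⟨0, two_pos, 0, Asymptotics.IsBigO.of_bound (|C| * 2 ^ N) (by
      refine eventually_inf_principal.2 (Eventually.of_forall fun ζ hζ => ?_)
      simpa using hbound ζ (le_of_lt hζ))⟩
    (by
      intro n
      have hlim : Tendsto (fun x : ℝ => (x + m) ^ 2) atTop atTop :=
        (tendsto_pow_atTop two_ne_zero).comp (tendsto_atTop_add_const_right _ _ tendsto_id)
      refine squeeze_zero' (Eventually.of_forall fun x => by positivity) ?_
        ((hdecay n).comp hlim)
      filter_upwards [eventually_ge_atTop 0] with x hx
      have h1 : (0 : ℝ) ≤ (x : ℂ).re := by simpa using hx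
      have h2 := hnorm x h1
      simp only [Function.comp_apply, hf]
      rw [Real.sqrt_sq (by linarith), ← Real.exp_nat_mul, norm_div]
      push_cast
      gcongr
      · linarith
      · refine div_le_self (norm_nonneg _) ?_
        rw [norm_pow _ N]
        exact one_le_pow₀ h2)
    ⟨|C| * 2 ^ N, fun x => hbound _ (by simp)⟩
  have hlarge : ∀ x : ℝ, m ^ 2 ≤ x → H x = 0 := by
    intro x hx
    have hx0 : 0 ≤ x := (sq_nonneg m).trans hx
    have hsx : m ≤ Real.sqrt x := Real.le_sqrt_of_sq_le hx
    have h1 : (0 : ℝ) ≤ ((Real.sqrt x - m : ℝ) : ℂ).re := by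
      rw [Complex.ofReal_re]
      linarith
    have h2 := hzero h1
    have h3 : (((Real.sqrt x - m : ℝ) : ℂ) + m) ^ 2 = x := by
      push_cast
      rw [sub_add_cancel, ← Complex.ofReal_pow, Real.sq_sqrt hx0]
    have h4 := hnorm _ h1
    simp only [hf, h3, Pi.zero_apply, div_eq_zero_iff, mul_eq_zero, Complex.exp_ne_zero,
      false_or] at h2
    rw [h3] at h4
    exact h2.resolve_right (pow_ne_zero _ (norm_pos_iff.1 (one_pos.trans_le h4)))
  -- The vanishing spreads from large `x` to the whole real axis by the identity theorem.
  have hreal : AnalyticOnNhd ℝ (fun x : ℝ => H x) Set.univ := fun x _ =>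
    ((h.analyticAt x).restrictScalars (𝕜 := ℝ)).comp (Complex.ofRealCLM.analyticAt x)
  exact hreal.eqOn_zero_of_preconnected_of_eventuallyEq_zero isPreconnected_univ
    (Set.mem_univ (m ^ 2 + 1)) (by
      filter_upwards [eventually_gt_nhds (lt_add_one (m ^ 2))] with x hx using hlarge x hx.le)
    (Set.mem_univ x)

/-- A function of tail rate `q > p` meets the decay hypothesis of `HasTailRate.eq_zero` for `p`. -/
lemma HasTailRate.tendsto_of_lt {p q : ℝ} (hpq : p < q) {H : ℂ → ℂ} (h : HasTailRate q H) (c : ℝ) :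
    Tendsto (fun x : ℝ => Real.exp (c * Real.sqrt x) * ‖Complex.exp (p * x) * H x‖)
      atTop (𝓝 0) := by
  obtain ⟨M, C, N, ht⟩ := h.tail
  have hlim : Tendsto (fun x : ℝ => |C| * 2 ^ N *
      Real.exp (Real.sqrt x * ((c + N) + (-(q - p)) * Real.sqrt x))) atTop (𝓝 0) := by
    rw [← mul_zero (|C| * 2 ^ N)]
    refine Tendsto.const_mul _ (Real.tendsto_exp_atBot.comp ?_)
    refine Real.tendsto_sqrt_atTop.atTop_mul_atBot₀ ?_
    exact tendsto_atBot_add_const_left _ _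
      (Real.tendsto_sqrt_atTop.const_mul_atTop_of_neg (by linarith))
  refine squeeze_zero' (Eventually.of_forall fun x => by positivity) ?_ hlim
  filter_upwards [eventually_ge_atTop (max M 0)] with x hx
  have hx0 : 0 ≤ x := (le_max_right _ _).trans hx
  have hxM : M ≤ parabolicHeight x := by
    rw [parabolicHeight, Complex.norm_real, Real.norm_of_nonneg hx0, Complex.ofReal_re]
    linarith [(le_max_left M 0).trans hx]
  have h1 := (ht x hxM).2
  rw [Complex.norm_real, Real.norm_of_nonneg hx0] at h1
  have h2 : Complex.exp (p * x) * H x =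
      (Real.exp (-(q - p) * x) : ℝ) * (Complex.exp (q * x) * H x) := by
    push_cast
    rw [← mul_assoc, ← Complex.exp_add]
    congr 2
    ring
  have h3 : 1 + x ≤ 2 * Real.exp (Real.sqrt x) := by
    have h4 := Real.quadratic_le_exp_of_nonneg (Real.sqrt_nonneg x)
    have h5 := Real.sq_sqrt hx0
    have h6 := Real.sqrt_nonneg x
    linarith
  have hexp : Real.sqrt x * ((c + N) + (-(q - p)) * Real.sqrt x) =
      c * Real.sqrt x + (-(q - p) * x + N * Real.sqrt x) := by
    linear_combination (-(q - p)) * Real.mul_self_sqrt hx0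
  rw [h2, norm_mul, Complex.norm_real, Real.norm_of_nonneg (Real.exp_pos _).le, hexp, Real.exp_add,
    Real.exp_add, Real.exp_nat_mul]
  calc _ ≤ Real.exp (c * Real.sqrt x) * (Real.exp (-(q - p) * x) *
        (|C| * (2 * Real.exp (Real.sqrt x)) ^ N)) := by
        gcongr
        refine h1.trans ?_
        gcongr
        exact le_abs_self C
    _ = _ := by rw [mul_pow]; ring

/-- In a vanishing finite sum of functions with tail rates, the terms of each rate sum to zero. -/
lemma sum_filter_tailRate_eq_zero {ι : Type*} {E : ι → ℂ → ℂ} {p : ι → ℝ} (t : Finset ι)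
    (h : ∀ i ∈ t, HasTailRate (p i) (E i)) (hsum : ∀ x : ℝ, ∑ i ∈ t, E i x = 0) (q : ℝ) (x : ℝ) :
    ∑ i ∈ t with p i = q, E i x = 0 := by
  classical
  induction t using Finset.strongInduction with
  | H t ih =>
    rcases t.eq_empty_or_nonempty with rfl | hne
    · simp
    obtain ⟨i₀, hi₀, hmin⟩ := t.exists_min_image p hne
    have hsplit : ∀ x : ℝ, ∑ i ∈ t with p i = p i₀, E i x = -∑ i ∈ t with ¬ p i = p i₀, E i x := by
      intro x
      rw [eq_neg_iff_add_eq_zero, Finset.sum_filter_add_sum_filter_not]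
      exact hsum x
    have hrate : HasTailRate (p i₀) (fun s => ∑ i ∈ t with p i = p i₀, E i s) := by
      refine HasTailRate.sum _ fun i hi => ?_
      rw [Finset.mem_filter] at hi
      exact hi.2 ▸ h i hi.1
    have hzero : ∀ x : ℝ, ∑ i ∈ t with p i = p i₀, E i x = 0 := by
      refine hrate.eq_zero fun c => ?_
      have hlim := tendsto_finsetSum (t.filter fun i => ¬ p i = p i₀) fun i hi =>
        ((h i (Finset.mem_filter.1 hi).1).tendsto_of_lt
          (lt_of_le_of_ne (hmin i (Finset.mem_filter.1 hi).1)
            (Ne.symm (Finset.mem_filter.1 hi).2)) c)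
      rw [Finset.sum_const_zero] at hlim
      refine squeeze_zero (fun x => by positivity) (fun x => ?_) hlim
      rw [hsplit x, mul_neg, norm_neg, Finset.mul_sum, ← Finset.mul_sum (f := fun i =>
        ‖Complex.exp (p i₀ * x) * E i x‖)]
      gcongr
      exact norm_sum_le _ _
    by_cases hq : p i₀ = q
    · subst hq
      exact hzero x
    · have hss : t.filter (fun i => ¬ p i = p i₀) ⊂ t :=
        Finset.filter_ssubset.2 ⟨i₀, hi₀, by simp⟩
      have hrest := ih _ hss (fun i hi => h i (Finset.mem_filter.1 hi).1) (fun x => by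
        have := hsplit x
        rw [hzero x] at this
        exact neg_eq_zero.1 this.symm)
      rw [Finset.filter_filter] at hrest
      rw [← hrest]
      refine Finset.sum_congr (Finset.filter_congr fun i _ => ?_) fun _ _ => rfl
      exact ⟨fun hi => ⟨fun h' => hq (h'.symm.trans hi), hi⟩, fun hi => hi.2⟩

/-! ### Continuation of the densities and separation by tail rates -/

/-- Holomorphic extension of `x ↦ √((x - μ)² + δ²)`, with branch cuts running to the left from
`μ ± iδ`. -/
noncomputable def ghRadius (μ δ : ℝ) (s : ℂ) : ℂ :=
  csqrt (s - μ + δ * Complex.I) * csqrt (s - μ - δ * Complex.I)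

lemma ghRadius_ofReal (μ : ℝ) {δ : ℝ} (hδ : 0 < δ) (x : ℝ) :
    ghRadius μ δ x = (Real.sqrt ((x - μ) ^ 2 + δ ^ 2) : ℝ) := by
  have hmem : (x - μ + δ * Complex.I : ℂ) ∈ Complex.slitPlane := by
    rw [Complex.mem_slitPlane_iff]
    right
    simpa using hδ.ne'
  have hconj : (x - μ - δ * Complex.I : ℂ) =
      (starRingEnd ℂ) (x - μ + δ * Complex.I : ℂ) := by
    simp [sub_eq_add_neg]
  have hc : csqrt (x - μ - δ * Complex.I) = (starRingEnd ℂ) (csqrt (x - μ + δ * Complex.I)) := by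
    rw [csqrt, csqrt, hconj, Complex.log_conj _ (Complex.mem_slitPlane_iff_arg.1 hmem).1,
      ← Complex.exp_conj, map_div₀, Complex.conj_ofNat]
  rw [ghRadius, hc, Complex.mul_conj, Complex.normSq_eq_norm_sq,
    norm_csqrt_sq (Complex.slitPlane_ne_zero hmem)]
  congr 1
  rw [Complex.norm_eq_sqrt_sq_add_sq]
  simp

lemma ghRadius_differentiableAt {μ δ : ℝ} {s : ℂ}
    (h1 : s - μ + δ * Complex.I ∈ Complex.slitPlane)
    (h2 : s - μ - δ * Complex.I ∈ Complex.slitPlane) : DifferentiableAt ℂ (ghRadius μ δ) s :=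
  (DifferentiableAt.fun_comp' (g := csqrt) s (csqrt_differentiableAt h1) (by fun_prop)).mul
    (DifferentiableAt.fun_comp' (g := csqrt) s (csqrt_differentiableAt h2) (by fun_prop))

/-- Since `2 (s - μ - r) = (√(s - μ + iδ) - √(s - μ - iδ))²` for the radius `r`, the radius differs
from `s - μ` by a bounded amount. -/
lemma norm_sub_ghRadius_le {μ δ : ℝ} (hδ : 0 < δ) {s : ℂ}
    (h1 : 2 ≤ parabolicHeight (s - μ + δ * Complex.I))
    (h2 : 2 ≤ parabolicHeight (s - μ - δ * Complex.I)) :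
    ‖s - μ - ghRadius μ δ s‖ ≤ δ ^ 2 := by
  have hs1 := csqrt_sq (Complex.slitPlane_ne_zero
    (mem_slitPlane_of_parabolicHeight_pos (two_pos.trans_le h1)))
  have hs2 := csqrt_sq (Complex.slitPlane_ne_zero
    (mem_slitPlane_of_parabolicHeight_pos (two_pos.trans_le h2)))
  have hr1 := one_le_csqrt_re h1
  have hr2 := one_le_csqrt_re h2
  unfold ghRadius
  set a := csqrt (s - μ + δ * Complex.I)
  set b := csqrt (s - μ - δ * Complex.I)
  have hsum : 2 ≤ ‖a + b‖ := by
    refine le_trans ?_ (Complex.re_le_norm _)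
    rw [Complex.add_re]
    linarith
  have hprod : ‖a - b‖ * ‖a + b‖ = 2 * δ := by
    rw [← norm_mul]
    have : (a - b) * (a + b) = 2 * δ * Complex.I := by linear_combination hs1 - hs2
    rw [this]
    simp [abs_of_pos hδ]
  have hab : ‖a - b‖ ≤ δ := by nlinarith [norm_nonneg (a - b)]
  have hsq : s - μ - a * b = (a - b) ^ 2 / 2 := by linear_combination -(hs1 + hs2) / 2
  rw [hsq, norm_div, norm_pow, Complex.norm_ofNat]
  nlinarith [norm_nonneg (a - b)]

/-- Holomorphic extension of the generalized hyperbolic density, up to a positive constant. -/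
noncomputable def ghExtension (ν α b μ δ : ℝ) (s : ℂ) : ℂ :=
  Complex.exp (b * s) * (ghRadius μ δ s ^ ((ν - 1 / 2 : ℝ) : ℂ) *
    Complex.exp (-(α * ghRadius μ δ s)) * besselPsi ν (csqrt (α * ghRadius μ δ s)))

lemma ofReal_mul_mem_slitPlane {c : ℝ} (hc : 0 < c) {w : ℂ} (hw : w ∈ Complex.slitPlane) :
    (c : ℂ) * w ∈ Complex.slitPlane := by
  rw [Complex.mem_slitPlane_iff] at *
  rw [Complex.re_ofReal_mul, Complex.im_ofReal_mul]
  exact hw.imp (mul_pos hc) (mul_ne_zero hc.ne')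

lemma ghExtension_differentiableAt (ν : ℝ) {α : ℝ} (hα : 0 < α) (b : ℝ) {μ δ : ℝ} {s : ℂ}
    (h1 : s - μ + δ * Complex.I ∈ Complex.slitPlane)
    (h2 : s - μ - δ * Complex.I ∈ Complex.slitPlane)
    (h3 : ghRadius μ δ s ∈ Complex.slitPlane) :
    DifferentiableAt ℂ (ghExtension ν α b μ δ) s := by
  have hr := ghRadius_differentiableAt h1 h2
  have h4 := ofReal_mul_mem_slitPlane hα h3
  have hq : DifferentiableAt ℂ (fun s => csqrt (α * ghRadius μ δ s)) s :=
    DifferentiableAt.fun_comp' (g := csqrt) s (csqrt_differentiableAt h4) (hr.const_mul _)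
  have hψ : DifferentiableAt ℂ (fun s => besselPsi ν (csqrt (α * ghRadius μ δ s))) s :=
    DifferentiableAt.fun_comp' (g := besselPsi ν) s
      (besselPsi_differentiableAt ν (csqrt_re_pos h4)) hq
  have hpow : DifferentiableAt ℂ (fun s => ghRadius μ δ s ^ ((ν - 1 / 2 : ℝ) : ℂ)) s :=
    hr.cpow (differentiableAt_const _) h3
  have hexp : DifferentiableAt ℂ (fun s => Complex.exp (-(α * ghRadius μ δ s))) s :=
    (hr.const_mul _).neg.cexp
  exact DifferentiableAt.mul (by fun_prop) ((hpow.mul hexp).mul hψ)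

lemma ghExtension_hasTailRate (ν : ℝ) {α : ℝ} (hα : 0 < α) (b μ : ℝ) {δ : ℝ} (hδ : 0 < δ) :
    HasTailRate (α - b) (ghExtension ν α b μ δ) := by
  constructor
  · intro x
    rw [Complex.analyticAt_iff_eventually_differentiableAt]
    have hm1 : (x : ℂ) - μ + δ * Complex.I ∈ Complex.slitPlane := by
      rw [Complex.mem_slitPlane_iff]
      right
      simpa using hδ.ne'
    have hm2 : (x : ℂ) - μ - δ * Complex.I ∈ Complex.slitPlane := by
      rw [Complex.mem_slitPlane_iff]
      right
      simpa using hδ.ne'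
    have hm3 : ghRadius μ δ x ∈ Complex.slitPlane := by
      rw [ghRadius_ofReal μ hδ]
      left
      rw [Complex.ofReal_re]
      positivity
    have hc1 : ContinuousAt (fun s : ℂ => s - μ + δ * Complex.I) x := by fun_prop
    have hc2 : ContinuousAt (fun s : ℂ => s - μ - δ * Complex.I) x := by fun_prop
    filter_upwards [hc1.eventually_mem (Complex.isOpen_slitPlane.mem_nhds hm1),
      hc2.eventually_mem (Complex.isOpen_slitPlane.mem_nhds hm2),
      (ghRadius_differentiableAt hm1 hm2).continuousAt.eventually_mem
        (Complex.isOpen_slitPlane.mem_nhds hm3)] with s h1 h2 h3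
    exact ghExtension_differentiableAt ν hα b h1 h2 h3
  · obtain ⟨C, hC0, hC⟩ := exists_norm_besselPsi_le ν
    obtain ⟨N, hN⟩ := exists_nat_ge (ν - 1 / 2)
    set D : ℝ := |μ| + δ + δ ^ 2 with hD
    have hD0 : 0 ≤ D := by positivity
    refine ⟨2 + 2 / α + 2 * D, Real.exp (α * D) * ((1 + D) ^ N * (C * (1 + α * (1 + D)))), N + 1,
      fun s hs => ?_⟩
    have hμ : ‖(μ : ℂ)‖ = |μ| := by rw [Complex.norm_real, Real.norm_eq_abs]
    have hδI : ‖(δ : ℂ) * Complex.I‖ = δ := by simp [abs_of_pos hδ]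
    have hα2 : 0 < 2 / α := by positivity
    have hh1 : 2 ≤ parabolicHeight (s - μ + δ * Complex.I) := by
      have h := parabolicHeight_le_add s (s - μ + δ * Complex.I)
      have h' : ‖s - (s - μ + δ * Complex.I)‖ ≤ |μ| + δ := by
        have e : s - (s - μ + δ * Complex.I) = μ - δ * Complex.I := by ring
        rw [e]
        exact (norm_sub_le _ _).trans_eq (by rw [hμ, hδI])
      nlinarith [sq_nonneg δ]
    have hh2 : 2 ≤ parabolicHeight (s - μ - δ * Complex.I) := by
      have h := parabolicHeight_le_add s (s - μ - δ * Complex.I)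
      have h' : ‖s - (s - μ - δ * Complex.I)‖ ≤ |μ| + δ := by
        have e : s - (s - μ - δ * Complex.I) = μ + δ * Complex.I := by ring
        rw [e]
        exact (norm_add_le _ _).trans_eq (by rw [hμ, hδI])
      nlinarith [sq_nonneg δ]
    have hsub := norm_sub_ghRadius_le hδ hh1 hh2
    set r := ghRadius μ δ s with hr
    have hdist : ‖s - r‖ ≤ D := by
      have h : s - r = (s - μ - r) + μ := by ring
      rw [h]
      refine (norm_add_le _ _).trans ?_
      rw [hμ, hD]
      linarith
    have hhr : 2 + 2 / α ≤ parabolicHeight r := by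
      have h := parabolicHeight_le_add s r
      linarith
    have hr1 : 1 ≤ ‖r‖ := by
      have h := norm_add_re_le_two_mul r
      have h' : parabolicHeight r = ‖r‖ + r.re := rfl
      linarith
    have hrs : ‖r‖ ≤ (1 + D) * (1 + ‖s‖) := by
      have h := norm_le_norm_add_norm_sub s r
      nlinarith [norm_nonneg s]
    have hαr : 2 ≤ parabolicHeight (α * r) := by
      rw [parabolicHeight_ofReal_mul hα.le]
      calc (2 : ℝ) = α * (2 / α) := by field_simp
        _ ≤ α * parabolicHeight r := by gcongr; linarith
    have hslit : r ∈ Complex.slitPlane :=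
      mem_slitPlane_of_parabolicHeight_pos (by linarith)
    refine ⟨ghExtension_differentiableAt ν hα b
      (mem_slitPlane_of_parabolicHeight_pos (two_pos.trans_le hh1))
      (mem_slitPlane_of_parabolicHeight_pos (two_pos.trans_le hh2)) hslit, ?_⟩
    have hcomb : Complex.exp ((α - b : ℝ) * s) * ghExtension ν α b μ δ s =
        Complex.exp (α * (s - r)) * (r ^ ((ν - 1 / 2 : ℝ) : ℂ) * besselPsi ν (csqrt (α * r))) := by
      have h : Complex.exp ((α - b : ℝ) * s) * Complex.exp (b * s) * Complex.exp (-(α * r)) =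
          Complex.exp (α * (s - r)) := by
        rw [← Complex.exp_add, ← Complex.exp_add]
        congr 1
        push_cast
        ring
      rw [← h, ghExtension, ← hr]
      ring
    have hb1 : ‖Complex.exp (α * (s - r))‖ ≤ Real.exp (α * D) := by
      rw [Complex.norm_exp]
      gcongr
      rw [Complex.re_ofReal_mul]
      have := (Complex.re_le_norm (s - r)).trans hdist
      gcongr
    have hb2 : ‖r ^ ((ν - 1 / 2 : ℝ) : ℂ)‖ ≤ (1 + D) ^ N * (1 + ‖s‖) ^ N := by
      rw [Complex.norm_cpow_real, ← mul_pow]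
      calc ‖r‖ ^ (ν - 1 / 2) ≤ ‖r‖ ^ (N : ℝ) := Real.rpow_le_rpow_of_exponent_le hr1 hN
        _ = ‖r‖ ^ N := Real.rpow_natCast _ _
        _ ≤ _ := by gcongr
    have hb3 : ‖besselPsi ν (csqrt (α * r))‖ ≤ C * (1 + α * (1 + D)) * (1 + ‖s‖) := by
      refine (hC _ (one_le_csqrt_re hαr)).trans ?_
      rw [mul_assoc]
      gcongr
      have h1 : ‖csqrt (α * r)‖ ^ 2 = α * ‖r‖ := by
        rw [norm_csqrt_sq (Complex.slitPlane_ne_zero (ofReal_mul_mem_slitPlane hα hslit)), norm_mul,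
          Complex.norm_real, Real.norm_of_nonneg hα.le]
      have h2 : ‖csqrt (α * r)‖ ≤ 1 + ‖csqrt (α * r)‖ ^ 2 := by nlinarith
      rw [h1] at h2
      have h3 := mul_le_mul_of_nonneg_left hrs hα.le
      nlinarith [norm_nonneg s]
    rw [hcomb, norm_mul, norm_mul]
    calc _ ≤ Real.exp (α * D) * ((1 + D) ^ N * (1 + ‖s‖) ^ N *
          (C * (1 + α * (1 + D)) * (1 + ‖s‖))) := by gcongr
      _ = _ := by ring

namespace GHParam

/-- The rate `α` with which the argument of the Bessel function in the density grows. -/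
noncomputable def alpha (θ : GHParam) : ℝ := Real.sqrt (θ.ω + θ.β ^ 2 / θ.σ ^ 2) / θ.σ

/-- The exponential tilt `b` of the density. -/
noncomputable def tilt (θ : GHParam) : ℝ := θ.β / θ.σ ^ 2

/-- The distance `δ` from the real axis of the branch points of the density. -/
noncomputable def delta (θ : GHParam) : ℝ := θ.σ * Real.sqrt θ.ω

lemma alpha_arg_pos (θ : GHParam) : 0 < θ.ω + θ.β ^ 2 / θ.σ ^ 2 := by
  have := θ.ω_pos
  positivity

lemma alpha_pos (θ : GHParam) : 0 < θ.alpha := div_pos (Real.sqrt_pos.2 θ.alpha_arg_pos) θ.σ_pos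

lemma delta_pos (θ : GHParam) : 0 < θ.delta := mul_pos θ.σ_pos (Real.sqrt_pos.2 θ.ω_pos)

lemma alpha_sq (θ : GHParam) : θ.alpha ^ 2 = θ.ω / θ.σ ^ 2 + θ.tilt ^ 2 := by
  have := θ.σ_pos
  rw [alpha, tilt, div_pow, Real.sq_sqrt θ.alpha_arg_pos.le]
  field_simp

lemma delta_sq (θ : GHParam) : θ.delta ^ 2 = θ.σ ^ 2 * θ.ω := by
  rw [delta, mul_pow, Real.sq_sqrt θ.ω_pos.le]

/-- The shape parameters determine `θ`, since `α² - b² = ω/σ²` and `δ² = σ² ω`. -/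
lemma eq_of_shape {θ θ' : GHParam} (h1 : θ.lam = θ'.lam) (h2 : θ.alpha = θ'.alpha)
    (h3 : θ.tilt = θ'.tilt) (h4 : θ.μ = θ'.μ) (h5 : θ.delta = θ'.delta) : θ = θ' := by
  have hσ := θ.σ_pos
  have hσ' := θ'.σ_pos
  have hω := θ.ω_pos
  have hω' := θ'.ω_pos
  have ha := θ.alpha_sq
  have hd := θ.delta_sq
  rw [h2, θ'.alpha_sq, h3] at ha
  rw [h5, θ'.delta_sq] at hd
  have e1 : θ'.ω / θ'.σ ^ 2 = θ.ω / θ.σ ^ 2 := by linarith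
  have e2 : θ.ω = θ'.ω := by
    have : θ'.ω ^ 2 = θ.ω ^ 2 := by
      calc θ'.ω ^ 2 = (θ'.σ ^ 2 * θ'.ω) * (θ'.ω / θ'.σ ^ 2) := by field_simp
        _ = (θ.σ ^ 2 * θ.ω) * (θ.ω / θ.σ ^ 2) := by rw [hd, e1]
        _ = θ.ω ^ 2 := by field_simp
    nlinarith
  have e3 : θ.σ = θ'.σ := by
    rw [e2] at hd
    have := mul_right_cancel₀ hω'.ne' hd
    nlinarith
  refine GHParam.ext h1 e2 h4 e3 ?_
  have h := h3
  rw [tilt, tilt, e3] at h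
  exact (div_left_inj' (by positivity)).1 h

/-- The parameters of the mirrored distribution, the law of `-X`. -/
def mirror (θ : GHParam) : GHParam := { θ with μ := -θ.μ, β := -θ.β }

lemma alpha_mirror (θ : GHParam) : θ.mirror.alpha = θ.alpha := by simp [alpha, mirror]

lemma tilt_mirror (θ : GHParam) : θ.mirror.tilt = -θ.tilt := by
  simp only [tilt, mirror]
  ring

end GHParam

lemma ghDensity_mirror (θ : GHParam) (x : ℝ) : ghDensity θ.mirror x = ghDensity θ (-x) := by
  have h : (-x - θ.μ) ^ 2 = (x - -θ.μ) ^ 2 := by ring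
  have h' : (-x - θ.μ) * θ.β = (x - -θ.μ) * -θ.β := by ring
  simp only [ghDensity, GHParam.mirror, neg_sq, h, h']

/-- The density in terms of the shape parameters. -/
lemma exists_ghDensity_eq (θ : GHParam) : ∃ C : ℝ, 0 < C ∧ ∀ x, ghDensity θ x =
    C * (Real.exp (θ.tilt * x) * (Real.sqrt ((x - θ.μ) ^ 2 + θ.delta ^ 2) ^ (θ.lam - 1 / 2) *
      besselK (θ.lam - 1 / 2) (θ.alpha * Real.sqrt ((x - θ.μ) ^ 2 + θ.delta ^ 2)))) := by
  have hσ := θ.σ_pos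
  have hω := θ.ω_pos
  have hA := θ.alpha_arg_pos
  have hK := besselK_pos θ.lam hω
  set A := θ.ω + θ.β ^ 2 / θ.σ ^ 2 with hAdef
  refine ⟨(1 / (θ.σ ^ 2 * A)) ^ ((θ.lam - 1 / 2) / 2) /
    (Real.sqrt (2 * Real.pi * θ.σ ^ 2) * besselK θ.lam θ.ω) * Real.exp (-(θ.μ * θ.tilt)),
    by positivity, fun x => ?_⟩
  set z := (x - θ.μ) ^ 2 + θ.delta ^ 2 with hz
  have hz0 : 0 < z := by have := θ.delta_pos; positivity
  have hB : θ.ω + (x - θ.μ) ^ 2 / θ.σ ^ 2 = z / θ.σ ^ 2 := by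
    rw [hz, θ.delta_sq]
    field_simp
    ring
  have h1 : Real.sqrt (A * (z / θ.σ ^ 2)) = θ.alpha * Real.sqrt z := by
    rw [Real.sqrt_mul hA.le, Real.sqrt_div hz0.le, Real.sqrt_sq hσ.le, GHParam.alpha, ← hAdef]
    ring
  have h2 : (z / θ.σ ^ 2 / A) ^ ((θ.lam - 1 / 2) / 2) =
      (1 / (θ.σ ^ 2 * A)) ^ ((θ.lam - 1 / 2) / 2) * Real.sqrt z ^ (θ.lam - 1 / 2) := by
    have : z / θ.σ ^ 2 / A = 1 / (θ.σ ^ 2 * A) * z := by field_simp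
    rw [this, Real.mul_rpow (by positivity) hz0.le, Real.sqrt_eq_rpow, ← Real.rpow_mul hz0.le]
    congr 2
    ring
  have h3 : Real.exp (-((x - θ.μ) * θ.β / θ.σ ^ 2)) =
      (Real.exp (-(θ.μ * θ.tilt)) * Real.exp (θ.tilt * x))⁻¹ := by
    rw [← Real.exp_add, ← Real.exp_neg, GHParam.tilt]
    congr 1
    field_simp
    ring
  rw [ghDensity, hB, ← hAdef, h1, h2, h3]
  field_simp

/-- Up to a positive factor, the density has a holomorphic extension with tail rate `α - b`. -/
lemma exists_hasTailRate_ghDensity (θ : GHParam) : ∃ E : ℂ → ℂ,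
    HasTailRate (θ.alpha - θ.tilt) E ∧ ∀ x : ℝ, E x = (ghDensity θ x : ℝ) := by
  obtain ⟨C, hC, hden⟩ := exists_ghDensity_eq θ
  have hα := θ.alpha_pos
  have hδ := θ.delta_pos
  refine ⟨fun s => ((C / Real.sqrt θ.alpha : ℝ) : ℂ) *
    ghExtension (θ.lam - 1 / 2) θ.alpha θ.tilt θ.μ θ.delta s,
    (ghExtension_hasTailRate _ hα _ _ hδ).const_mul _, fun x => ?_⟩
  simp only
  rw [hden x, ghExtension, ghRadius_ofReal _ hδ]
  set r := Real.sqrt ((x - θ.μ) ^ 2 + θ.delta ^ 2) with hr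
  have hr0 : 0 < r := Real.sqrt_pos.2 (by positivity)
  rw [← Complex.ofReal_mul θ.alpha, csqrt_ofReal (by positivity), besselPsi_sqrt _ (by positivity),
    ← Complex.ofReal_cpow hr0.le]
  have h1 : r ^ (θ.lam - 1 / 2 - 1 / 2) * Real.sqrt (θ.alpha * r) =
      r ^ (θ.lam - 1 / 2) * Real.sqrt θ.alpha := by
    rw [Real.rpow_sub hr0 (θ.lam - 1 / 2), Real.sqrt_mul hα.le, ← Real.sqrt_eq_rpow]
    have := Real.sqrt_pos.2 hr0
    field_simp
  have h2 : Real.exp (-(θ.alpha * r)) * Real.exp (θ.alpha * r) = 1 := by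
    rw [← Real.exp_add, neg_add_cancel, Real.exp_zero]
  have h3 := Real.sqrt_pos.2 hα
  norm_cast
  rw [div_mul_eq_mul_div, div_eq_iff h3.ne']
  linear_combination (C * Real.exp (θ.tilt * x) * besselK (θ.lam - 1 / 2) (θ.alpha * r) *
    Real.exp (-(θ.alpha * r)) * Real.exp (θ.alpha * r)) * h1 + (C * Real.exp (θ.tilt * x) *
    besselK (θ.lam - 1 / 2) (θ.alpha * r) * r ^ (θ.lam - 1 / 2) * Real.sqrt θ.alpha) * h2

lemma sum_filter_rate_eq_zero (t : Finset GHParam) (c : GHParam → ℝ)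
    (hsum : ∀ x, ∑ θ ∈ t, c θ * ghDensity θ x = 0) (q x : ℝ) :
    ∑ θ ∈ t with θ.alpha - θ.tilt = q, c θ * ghDensity θ x = 0 := by
  choose E hE hEx using exists_hasTailRate_ghDensity
  have h := sum_filter_tailRate_eq_zero (E := fun θ s => (c θ : ℂ) * E θ s)
    (p := fun θ => θ.alpha - θ.tilt) t (fun θ _ => (hE θ).const_mul _) (fun x => by
      simp only [hEx]
      exact_mod_cast hsum x) q x
  simp only [hEx] at h
  exact_mod_cast h

/-- In a vanishing linear combination of densities, the terms with given tail rates `q` at `+∞` and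
`q'` at `-∞` sum to zero. -/
lemma sum_filter_rates_eq_zero (t : Finset GHParam) (c : GHParam → ℝ)
    (hsum : ∀ x, ∑ θ ∈ t, c θ * ghDensity θ x = 0) (q q' x : ℝ) :
    ∑ θ ∈ t with θ.alpha - θ.tilt = q ∧ θ.alpha + θ.tilt = q', c θ * ghDensity θ x = 0 := by
  choose E hE hEx using fun θ : GHParam => exists_hasTailRate_ghDensity θ.mirror
  have h := sum_filter_tailRate_eq_zero (E := fun θ s => (c θ : ℂ) * E θ s)
    (p := fun θ => θ.mirror.alpha - θ.mirror.tilt) (t.filter fun θ => θ.alpha - θ.tilt = q)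
    (fun θ _ => (hE θ).const_mul _) (fun x => by
      simp only [hEx, ghDensity_mirror]
      exact_mod_cast sum_filter_rate_eq_zero t c hsum q (-x)) q' (-x)
  simp only [hEx, ghDensity_mirror, GHParam.alpha_mirror, GHParam.tilt_mirror, sub_neg_eq_add,
    neg_neg, Finset.filter_filter] at h
  exact_mod_cast h

/-! ### Fourier transforms of the densities and their leading asymptotics -/

lemma integrable_exp_neg_sub_sq_div (μ : ℝ) {v : ℝ} (hv : 0 < v) :
    Integrable (fun x : ℝ => Real.exp (-((x - μ) ^ 2 / (2 * v)))) := by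
  have h := (integrable_exp_neg_mul_sq (b := 1 / (2 * v)) (by positivity)).comp_sub_right μ
  refine h.congr (ae_of_all _ fun x => ?_)
  simp only
  congr 1
  ring

lemma integral_exp_neg_sub_sq_div (μ : ℝ) (v : ℝ) :
    ∫ x : ℝ, Real.exp (-((x - μ) ^ 2 / (2 * v))) = Real.sqrt (2 * Real.pi * v) := by
  rw [integral_sub_right_eq_self (fun x : ℝ => Real.exp (-(x ^ 2 / (2 * v)))) μ]
  have h := integral_gaussian (1 / (2 * v))
  have e : Real.pi / (1 / (2 * v)) = 2 * Real.pi * v := by rw [div_div_eq_mul_div]; ring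
  rw [e] at h
  rw [← h]
  congr 1
  ext x
  congr 1
  ring

lemma integral_cexp_mul_exp_neg_sub_sq_div (t μ : ℝ) {v : ℝ} (hv : 0 < v) :
    ∫ x : ℝ, Complex.exp (Complex.I * t * x) * (Real.exp (-((x - μ) ^ 2 / (2 * v))) : ℝ) =
      Complex.exp (Complex.I * t * μ) *
        (Real.sqrt (2 * Real.pi * v) * Real.exp (-(t ^ 2 / 2 * v)) : ℝ) := by
  rw [← integral_add_right_eq_self _ μ]
  have h := fourierIntegral_gaussian (b := ((1 / (2 * v) : ℝ) : ℂ))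
    (by rw [Complex.ofReal_re]; positivity) t
  have e1 : ((Real.pi : ℂ) / ((1 / (2 * v) : ℝ) : ℂ)) ^ (1 / 2 : ℂ) =
      (Real.sqrt (2 * Real.pi * v) : ℝ) := by
    have e : ((Real.pi : ℂ) / ((1 / (2 * v) : ℝ) : ℂ)) = ((2 * Real.pi * v : ℝ) : ℂ) := by
      have : (v : ℂ) ≠ 0 := by exact_mod_cast hv.ne'
      push_cast
      field_simp
    rw [e, Real.sqrt_eq_rpow, Complex.ofReal_cpow (by positivity)]
    norm_num
  have e2 : -(t : ℂ) ^ 2 / (4 * ((1 / (2 * v) : ℝ) : ℂ)) = ((-(t ^ 2 / 2 * v) : ℝ) : ℂ) := by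
    have : (v : ℂ) ≠ 0 := by exact_mod_cast hv.ne'
    push_cast
    field_simp
    ring
  rw [e1, e2] at h
  rw [Complex.ofReal_mul, Complex.ofReal_exp, ← h, ← integral_const_mul]
  congr 1
  ext x
  rw [Complex.ofReal_exp, ← mul_assoc, ← Complex.exp_add, ← Complex.exp_add, ← Complex.exp_add]
  congr 1
  push_cast
  ring

/-- Integrand of the representation of the untilted density as a mixture over `v` of Gaussians in
`x` with variance `v`. -/
lemma gig_integrand_eq (ν B μ δ x : ℝ) {v : ℝ} (hv : 0 < v) :
    v ^ (ν - 1) * Real.exp (-(((x - μ) ^ 2 + δ ^ 2) / 2 / v) - B * v) =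
      Real.exp (-((x - μ) ^ 2 / (2 * v))) *
        (v ^ (ν - 1) * Real.exp (-(δ ^ 2 / 2 / v) - B * v)) := by
  rw [mul_left_comm, ← Real.exp_add]
  congr 2
  field_simp
  ring

lemma sqrt_mul_gig_integrand (ν A B t : ℝ) {v : ℝ} (hv : 0 < v) :
    Real.sqrt (2 * Real.pi * v) * Real.exp (-(t ^ 2 / 2 * v)) *
        (v ^ (ν - 1) * Real.exp (-(A / v) - B * v)) =
      Real.sqrt (2 * Real.pi) *
        (v ^ (ν + 1 / 2 - 1) * Real.exp (-(A / v) - (B + t ^ 2 / 2) * v)) := by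
  have e1 : ν + 1 / 2 - 1 = 1 / 2 + (ν - 1) := by ring
  have e2 : -(A / v) - (B + t ^ 2 / 2) * v = -(t ^ 2 / 2 * v) + (-(A / v) - B * v) := by ring
  rw [Real.sqrt_mul (by positivity), e1, e2, Real.rpow_add hv, Real.exp_add, ← Real.sqrt_eq_rpow]
  ring

lemma gig_integrable_prod (ν : ℝ) {B : ℝ} (hB : 0 < B) (μ : ℝ) {δ : ℝ} (hδ : 0 < δ) (t : ℝ) :
    Integrable (Function.uncurry fun x v : ℝ => Complex.exp (Complex.I * t * x) *
      ((v ^ (ν - 1) * Real.exp (-(((x - μ) ^ 2 + δ ^ 2) / 2 / v) - B * v) : ℝ) : ℂ))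
      (volume.prod (volume.restrict (Set.Ioi 0))) := by
  have hnorm : ∀ x v : ℝ, 0 < v → ‖Complex.exp (Complex.I * t * x) *
      ((v ^ (ν - 1) * Real.exp (-(((x - μ) ^ 2 + δ ^ 2) / 2 / v) - B * v) : ℝ) : ℂ)‖ =
      Real.exp (-((x - μ) ^ 2 / (2 * v))) *
        (v ^ (ν - 1) * Real.exp (-(δ ^ 2 / 2 / v) - B * v)) := by
    intro x v hv
    have e : Complex.I * t * x = ((t * x : ℝ) : ℂ) * Complex.I := by push_cast; ring
    rw [norm_mul, e, Complex.norm_exp_ofReal_mul_I, one_mul, Complex.norm_real,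
      Real.norm_of_nonneg (by positivity), gig_integrand_eq ν B μ δ x hv]
  have hmeas : AEStronglyMeasurable (Function.uncurry fun x v : ℝ =>
      Complex.exp (Complex.I * t * x) *
      ((v ^ (ν - 1) * Real.exp (-(((x - μ) ^ 2 + δ ^ 2) / 2 / v) - B * v) : ℝ) : ℂ))
      (volume.prod (volume.restrict (Set.Ioi 0))) := by
    refine Measurable.aestronglyMeasurable ?_
    unfold Function.uncurry
    fun_prop
  rw [integrable_prod_iff' hmeas]
  constructor
  · refine (ae_restrict_iff' measurableSet_Ioi).2 (ae_of_all _ fun v hv => ?_)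
    have hv : 0 < v := hv
    refine Integrable.mono' ((integrable_exp_neg_sub_sq_div μ hv).mul_const
      (v ^ (ν - 1) * Real.exp (-(δ ^ 2 / 2 / v) - B * v))) ?_ (ae_of_all _ fun x => ?_)
    · refine Measurable.aestronglyMeasurable ?_
      simp only [Function.uncurry]
      fun_prop
    · exact (hnorm x v hv).le
  · have h := ((gig_integrableOn (ν + 1 / 2) (A := δ ^ 2 / 2) (by positivity) hB).const_mul
      (Real.sqrt (2 * Real.pi)))
    refine h.congr ((ae_restrict_iff' measurableSet_Ioi).2 (ae_of_all _ fun v hv => ?_))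
    have hv : 0 < v := hv
    simp only [Function.uncurry, hnorm _ v hv]
    rw [integral_mul_const, integral_exp_neg_sub_sq_div]
    have := sqrt_mul_gig_integrand ν (δ ^ 2 / 2) B 0 hv
    simpa using this.symm

lemma gigIntegral_integrable (ν : ℝ) {B : ℝ} (hB : 0 < B) (μ : ℝ) {δ : ℝ} (hδ : 0 < δ) (t : ℝ) :
    Integrable (fun x : ℝ => Complex.exp (Complex.I * t * x) *
      (gigIntegral ν (((x - μ) ^ 2 + δ ^ 2) / 2) B : ℝ)) := by
  refine (gig_integrable_prod ν hB μ hδ t).integral_prod_left.congr (ae_of_all _ fun x => ?_)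
  simp only [Function.uncurry]
  rw [integral_const_mul, integral_complex_ofReal]
  rfl

/-- The Fourier transform of the untilted density, by Fubini and the Gaussian Fourier transform. -/
lemma fourier_gigIntegral (ν : ℝ) {B : ℝ} (hB : 0 < B) (μ : ℝ) {δ : ℝ} (hδ : 0 < δ) (t : ℝ) :
    ∫ x : ℝ, Complex.exp (Complex.I * t * x) *
      (gigIntegral ν (((x - μ) ^ 2 + δ ^ 2) / 2) B : ℝ) =
    Complex.exp (Complex.I * t * μ) * ((Real.sqrt (2 * Real.pi) *
      gigIntegral (ν + 1 / 2) (δ ^ 2 / 2) (B + t ^ 2 / 2) : ℝ) : ℂ) := by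
  have hswap := integral_integral_swap (gig_integrable_prod ν hB μ hδ t)
  have hleft : ∀ x : ℝ, ∫ v in Set.Ioi (0 : ℝ), Complex.exp (Complex.I * t * x) *
      ((v ^ (ν - 1) * Real.exp (-(((x - μ) ^ 2 + δ ^ 2) / 2 / v) - B * v) : ℝ) : ℂ) =
      Complex.exp (Complex.I * t * x) * (gigIntegral ν (((x - μ) ^ 2 + δ ^ 2) / 2) B : ℝ) := by
    intro x
    rw [integral_const_mul, integral_complex_ofReal]
    rfl
  simp only [hleft] at hswap
  rw [hswap, gigIntegral, ← integral_const_mul, ← integral_complex_ofReal, ← integral_const_mul]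
  refine setIntegral_congr_fun measurableSet_Ioi fun v hv => ?_
  have hv : 0 < v := hv
  simp only [gig_integrand_eq ν B μ δ _ hv]
  rw [← sqrt_mul_gig_integrand ν (δ ^ 2 / 2) B t hv, Complex.ofReal_mul, ← mul_assoc,
    ← integral_cexp_mul_exp_neg_sub_sq_div t μ hv, ← integral_mul_const]
  congr 1
  ext x
  push_cast
  ring

lemma besselK_tendsto (ν : ℝ) :
    Tendsto (fun x : ℝ => Real.sqrt x * Real.exp x * besselK ν x) atTop
      (𝓝 (Real.sqrt (Real.pi / 2))) := by
  have h := (Complex.continuous_re.tendsto _).comp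
    ((besselPsi_tendsto ν).comp Real.tendsto_sqrt_atTop)
  rw [Complex.ofReal_re] at h
  refine h.congr' ?_
  filter_upwards [eventually_gt_atTop 0] with x hx
  simp only [Function.comp_apply]
  rw [besselPsi_sqrt ν hx, Complex.ofReal_re]

lemma gigIntegral_tendsto (a : ℝ) {δ : ℝ} (hδ : 0 < δ) : ∃ κ : ℝ, 0 < κ ∧
    Tendsto (fun T : ℝ => Real.exp (δ * T) * T ^ (a + 1 / 2) *
      gigIntegral a (δ ^ 2 / 2) (T ^ 2 / 2)) atTop (𝓝 κ) := by
  refine ⟨2 * δ ^ (a - 1 / 2) * Real.sqrt (Real.pi / 2), by positivity, ?_⟩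
  have h := ((besselK_tendsto a).comp (tendsto_id.const_mul_atTop hδ)).const_mul
    (2 * δ ^ (a - 1 / 2))
  refine h.congr' ?_
  filter_upwards [eventually_gt_atTop 0] with T hT
  have e1 : Real.sqrt (δ ^ 2 / 2 / (T ^ 2 / 2)) = δ / T := by
    rw [div_div_div_cancel_right₀ two_ne_zero, ← div_pow, Real.sqrt_sq (by positivity)]
  have e2 : 2 * Real.sqrt (δ ^ 2 / 2 * (T ^ 2 / 2)) = δ * T := by
    have : δ ^ 2 / 2 * (T ^ 2 / 2) = (δ * T / 2) ^ 2 := by ring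
    rw [this, Real.sqrt_sq (by positivity)]
    ring
  simp only [Function.comp_apply, id]
  rw [gigIntegral_eq_besselK a (by positivity) (by positivity), e1, e2,
    Real.div_rpow hδ.le hT.le, Real.rpow_add hT, Real.rpow_sub hδ, Real.sqrt_mul hδ.le,
    ← Real.sqrt_eq_rpow, ← Real.sqrt_eq_rpow]
  have h1 := Real.sqrt_pos.2 hδ
  have h2 := Real.rpow_pos_of_pos hT a
  field_simp

/-- After normalisation by the leading behaviour for `(δ₀, a₀)`, an integral with lexicographically
larger `(δ, a)` is negligible. -/
lemma gigIntegral_tendsto_zero {a a₀ δ δ₀ : ℝ} (hδ : 0 < δ)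
    (hlt : δ₀ < δ ∨ δ₀ = δ ∧ a₀ < a) :
    Tendsto (fun T : ℝ => Real.exp (δ₀ * T) * T ^ (a₀ + 1 / 2) *
      gigIntegral a (δ ^ 2 / 2) (T ^ 2 / 2)) atTop (𝓝 0) := by
  obtain ⟨κ, -, hκ⟩ := gigIntegral_tendsto a hδ
  have hratio : Tendsto (fun T : ℝ => T ^ (a₀ - a) * Real.exp (-(δ - δ₀) * T)) atTop (𝓝 0) := by
    rcases hlt with h | ⟨rfl, h⟩
    · exact tendsto_rpow_mul_exp_neg_mul_atTop_nhds_zero _ _ (by linarith)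
    · have h' := tendsto_rpow_neg_atTop (y := a - a₀) (by linarith)
      simpa using h'
  have h := hκ.mul hratio
  rw [mul_zero] at h
  refine h.congr' ?_
  filter_upwards [eventually_gt_atTop 0] with T hT
  have e1 : Real.exp (δ₀ * T) = Real.exp (δ * T) * Real.exp (-(δ - δ₀) * T) := by
    rw [← Real.exp_add]
    congr 1
    ring
  have e2 : T ^ (a₀ + 1 / 2) = T ^ (a + 1 / 2) * T ^ (a₀ - a) := by
    rw [← Real.rpow_add hT]
    congr 1
    ring
  rw [e1, e2]
  ring

/-- A trigonometric sum with distinct frequencies that tends to zero has zero coefficients. -/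
lemma coeff_eq_zero_of_tendsto_exp_sum {ι : Type*} (s : Finset ι) (μ : ι → ℝ)
    (hμ : Set.InjOn μ s) (d : ι → ℂ)
    (hlim : Tendsto (fun t : ℝ => ∑ i ∈ s, d i * Complex.exp (Complex.I * t * μ i)) atTop (𝓝 0)) :
    ∀ i ∈ s, d i = 0 := by
  classical
  induction s using Finset.induction_on generalizing d with
  | empty => simp
  | insert a s ha ih =>
    have hs : ∀ i ∈ s, d i = 0 := by
      intro i hi
      have hne : μ i - μ a ≠ 0 := fun h => ha (by
        have := hμ (Finset.mem_coe.2 (Finset.mem_insert_of_mem hi))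
          (Finset.mem_coe.2 (Finset.mem_insert_self a s)) (sub_eq_zero.1 h)
        exact this ▸ hi)
      -- A shift by `h` combined with the phase of frequency `μ a` removes that frequency and
      -- multiplies the coefficient of `μ i` by `-2` times a phase.
      set h : ℝ := Real.pi / (μ i - μ a) with hh
      have hshift := (hlim.comp (tendsto_atTop_add_const_right _ h tendsto_id)).sub
        (hlim.const_mul (Complex.exp (Complex.I * h * μ a)))
      rw [mul_zero, sub_zero] at hshift
      have hres := ih (hμ.mono (Finset.coe_subset.2 (Finset.subset_insert a s)))
        (fun j => d j * (Complex.exp (Complex.I * h * μ j) - Complex.exp (Complex.I * h * μ a)))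
        (hshift.congr fun t => by
          simp only [Function.comp_apply, id, Finset.sum_insert ha, mul_add, Finset.mul_sum]
          have e : ∀ j, Complex.exp (Complex.I * ((t + h : ℝ) : ℂ) * μ j) =
              Complex.exp (Complex.I * t * μ j) * Complex.exp (Complex.I * h * μ j) := by
            intro j
            rw [← Complex.exp_add]
            congr 1
            push_cast
            ring
          simp only [e]
          rw [add_sub_add_comm, ← Finset.sum_sub_distrib]
          have e0 : d a * (Complex.exp (Complex.I * t * μ a) * Complex.exp (Complex.I * h * μ a)) -
              Complex.exp (Complex.I * h * μ a) * (d a * Complex.exp (Complex.I * t * μ a)) = 0 := by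
            ring
          rw [e0, zero_add]
          exact Finset.sum_congr rfl fun j _ => by ring) i hi
      refine (mul_eq_zero.1 hres).resolve_right ?_
      have e : Complex.exp (Complex.I * h * μ i) =
          -Complex.exp (Complex.I * h * μ a) := by
        have e' : Complex.I * h * μ i = Complex.I * h * μ a + Real.pi * Complex.I := by
          have : (h : ℂ) * (μ i - μ a) = Real.pi := by
            rw [hh]
            norm_cast
            exact div_mul_cancel₀ _ hne
          linear_combination Complex.I * this
        rw [e', Complex.exp_add, Complex.exp_pi_mul_I]
        ring
      rw [e]
      have h0 := Complex.exp_ne_zero (Complex.I * h * μ a)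
      intro hzero
      exact h0 (by linear_combination -hzero / 2)
    intro i hi
    rcases Finset.mem_insert.1 hi with rfl | hi
    · have hnorm := hlim.norm
      rw [norm_zero] at hnorm
      have hconst : Tendsto (fun _ : ℝ => ‖d i‖) atTop (𝓝 0) := by
        refine hnorm.congr fun t => ?_
        rw [Finset.sum_insert ha, Finset.sum_eq_zero fun j hj => by rw [hs j hj, zero_mul],
          add_zero, norm_mul]
        have e : Complex.I * t * μ i = ((t * μ i : ℝ) : ℂ) * Complex.I := by push_cast; ring
        rw [e, Complex.norm_exp_ofReal_mul_I, mul_one]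
      exact norm_eq_zero.1 (tendsto_nhds_unique tendsto_const_nhds hconst)
    · exact hs i hi

/-! ### Linear independence and identifiability -/

lemma exists_ghDensity_eq_gigIntegral (θ : GHParam) : ∃ D : ℝ, 0 < D ∧ ∀ x, ghDensity θ x =
    D * (Real.exp (θ.tilt * x) *
      gigIntegral (θ.lam - 1 / 2) (((x - θ.μ) ^ 2 + θ.delta ^ 2) / 2) (θ.alpha ^ 2 / 2)) := by
  obtain ⟨C, hC, hden⟩ := exists_ghDensity_eq θ
  have hα := θ.alpha_pos
  have hδ := θ.delta_pos
  refine ⟨C * θ.alpha ^ (θ.lam - 1 / 2) / 2, by positivity, fun x => ?_⟩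
  set z := (x - θ.μ) ^ 2 + θ.delta ^ 2 with hz
  have hz0 : 0 < z := by positivity
  have e1 : Real.sqrt (z / 2 / (θ.alpha ^ 2 / 2)) = Real.sqrt z / θ.alpha := by
    rw [div_div_div_cancel_right₀ two_ne_zero, Real.sqrt_div hz0.le, Real.sqrt_sq hα.le]
  have e2 : 2 * Real.sqrt (z / 2 * (θ.alpha ^ 2 / 2)) = θ.alpha * Real.sqrt z := by
    have : z / 2 * (θ.alpha ^ 2 / 2) = (θ.alpha / 2) ^ 2 * z := by ring
    rw [this, Real.sqrt_mul (by positivity), Real.sqrt_sq (by positivity)]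
    ring
  rw [hden x, ← hz, gigIntegral_eq_besselK _ (by positivity) (by positivity), e1, e2,
    Real.div_rpow (Real.sqrt_nonneg z) hα.le]
  have := Real.rpow_pos_of_pos hα (θ.lam - 1 / 2)
  field_simp

/-- The vanishing of a linear combination of densities with common `α` and `b`, after Fourier
transformation. -/
lemma sum_fourier_eq_zero {α b : ℝ} (hα : 0 < α) (t : Finset GHParam) (d : GHParam → ℝ)
    (hsum : ∀ x, ∑ θ ∈ t, d θ * (Real.exp (b * x) *
      gigIntegral (θ.lam - 1 / 2) (((x - θ.μ) ^ 2 + θ.delta ^ 2) / 2) (α ^ 2 / 2)) = 0) (u : ℝ) :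
    ∑ θ ∈ t, (d θ : ℂ) * (Complex.exp (Complex.I * u * θ.μ) *
      (gigIntegral θ.lam (θ.delta ^ 2 / 2) (Real.sqrt (α ^ 2 + u ^ 2) ^ 2 / 2) : ℝ)) = 0 := by
  have hB : 0 < α ^ 2 / 2 := by positivity
  have hsum' : ∀ x : ℝ, ∑ θ ∈ t, (d θ : ℂ) * (Complex.exp (Complex.I * u * x) *
      (gigIntegral (θ.lam - 1 / 2) (((x - θ.μ) ^ 2 + θ.delta ^ 2) / 2) (α ^ 2 / 2) : ℝ)) = 0 := by
    intro x
    have h := hsum x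
    simp only [mul_left_comm _ (Real.exp (b * x))] at h
    rw [← Finset.mul_sum, mul_eq_zero] at h
    have h := h.resolve_left (Real.exp_pos _).ne'
    simp only [mul_left_comm _ (Complex.exp (Complex.I * u * x))]
    rw [← Finset.mul_sum, mul_eq_zero]
    exact Or.inr (by exact_mod_cast h)
  have hint : ∫ x : ℝ, ∑ θ ∈ t, (d θ : ℂ) * (Complex.exp (Complex.I * u * x) *
      (gigIntegral (θ.lam - 1 / 2) (((x - θ.μ) ^ 2 + θ.delta ^ 2) / 2) (α ^ 2 / 2) : ℝ)) = 0 := by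
    simp only [hsum', integral_zero]
  rw [integral_finsetSum _ fun θ _ =>
    (gigIntegral_integrable _ hB θ.μ θ.delta_pos u).const_mul _] at hint
  simp only [integral_const_mul, fourier_gigIntegral _ hB _ (GHParam.delta_pos _),
    sub_add_cancel] at hint
  have hs : ((Real.sqrt (2 * Real.pi) : ℝ) : ℂ) ≠ 0 := by
    have : 0 < Real.sqrt (2 * Real.pi) := by positivity
    exact_mod_cast this.ne'
  refine (mul_eq_zero.1 ?_).resolve_left hs
  rw [← hint, Finset.mul_sum]
  refine Finset.sum_congr rfl fun θ _ => ?_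
  have e : Real.sqrt (α ^ 2 + u ^ 2) ^ 2 / 2 = α ^ 2 / 2 + u ^ 2 / 2 := by
    rw [Real.sq_sqrt (by positivity)]
    ring
  rw [e, Complex.ofReal_mul]
  ring

/-- Densities with common `α` and `b` are linearly independent: at high frequencies the Fourier
transforms are separated by `δ`, then by the index `λ`, then by the phase `μ`. -/
lemma coeff_eq_zero_of_common_rates {α b : ℝ} (t : Finset GHParam)
    (hα : ∀ θ ∈ t, θ.alpha = α) (hb : ∀ θ ∈ t, θ.tilt = b) (c : GHParam → ℝ)
    (hsum : ∀ x, ∑ θ ∈ t, c θ * ghDensity θ x = 0) : ∀ θ ∈ t, c θ = 0 := by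
  classical
  choose D hD hden using exists_ghDensity_eq_gigIntegral
  by_contra! hex
  obtain ⟨θ₁, hθ₁, hcθ₁⟩ := hex
  have hα0 : 0 < α := hα θ₁ hθ₁ ▸ θ₁.alpha_pos
  set s := t.filter fun θ => c θ ≠ 0 with hs
  have hst : ∀ θ ∈ s, θ ∈ t := fun θ hθ => (Finset.mem_filter.1 hθ).1
  obtain ⟨θ₀, hθ₀, hmin⟩ := s.exists_min_image (fun θ => toLex (θ.delta, θ.lam))
    ⟨θ₁, Finset.mem_filter.2 ⟨hθ₁, hcθ₁⟩⟩
  have hF := sum_fourier_eq_zero (b := b) hα0 s (fun θ => c θ * D θ) (fun x => by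
    rw [← hsum x, hs, Finset.sum_filter_of_ne (p := fun θ => c θ ≠ 0)
      fun θ _ h hc => h (by simp only [hc, zero_mul])]
    refine Finset.sum_congr rfl fun θ hθ => ?_
    rw [hden θ x, hα θ hθ, hb θ hθ]
    ring)
  -- The normalised transforms converge, and the limit is nonzero exactly for the leading terms.
  have hlim : ∀ θ ∈ s, ∃ κ : ℝ, (θ.delta = θ₀.delta ∧ θ.lam = θ₀.lam → κ ≠ 0) ∧
      (¬ (θ.delta = θ₀.delta ∧ θ.lam = θ₀.lam) → κ = 0) ∧
      Tendsto (fun T : ℝ => Real.exp (θ₀.delta * T) * T ^ (θ₀.lam + 1 / 2) *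
        gigIntegral θ.lam (θ.delta ^ 2 / 2) (T ^ 2 / 2)) atTop (𝓝 κ) := by
    intro θ hθ
    by_cases h : θ.delta = θ₀.delta ∧ θ.lam = θ₀.lam
    · obtain ⟨κ, hκ, hT⟩ := gigIntegral_tendsto θ.lam θ.delta_pos
      rw [h.1, h.2] at hT
      refine ⟨κ, fun _ => hκ.ne', fun h' => absurd h h', ?_⟩
      rwa [h.1, h.2]
    · refine ⟨0, fun h' => absurd h' h, fun _ => rfl, gigIntegral_tendsto_zero θ.delta_pos ?_⟩
      rcases Prod.Lex.le_iff.1 (hmin θ hθ) with h1 | ⟨h1, h2⟩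
      · exact Or.inl h1
      · exact Or.inr ⟨h1, lt_of_le_of_ne h2 fun h3 => h ⟨h1.symm, h3.symm⟩⟩
  choose! κ hκ hκ0 hκT using hlim
  have hTtop : Tendsto (fun u : ℝ => Real.sqrt (α ^ 2 + u ^ 2)) atTop atTop :=
    Real.tendsto_sqrt_atTop.comp
      (tendsto_atTop_add_const_left _ _ (tendsto_pow_atTop two_ne_zero))
  have hdiff : Tendsto (fun u : ℝ => ∑ θ ∈ s, ((c θ * D θ * κ θ : ℝ) : ℂ) *
      Complex.exp (Complex.I * u * θ.μ)) atTop (𝓝 0) := by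
    have hterm : ∀ θ ∈ s, Tendsto (fun u : ℝ => ((c θ * D θ * (κ θ -
        Real.exp (θ₀.delta * Real.sqrt (α ^ 2 + u ^ 2)) *
          Real.sqrt (α ^ 2 + u ^ 2) ^ (θ₀.lam + 1 / 2) *
          gigIntegral θ.lam (θ.delta ^ 2 / 2) (Real.sqrt (α ^ 2 + u ^ 2) ^ 2 / 2)) : ℝ) : ℂ) *
        Complex.exp (Complex.I * u * θ.μ)) atTop (𝓝 0) := by
      intro θ hθ
      have h := (((hκT θ hθ).comp hTtop).const_sub (κ θ)).const_mul (c θ * D θ)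
      rw [sub_self, mul_zero] at h
      rw [tendsto_zero_iff_norm_tendsto_zero] at h ⊢
      refine h.congr fun u => ?_
      have e : Complex.I * u * θ.μ = ((u * θ.μ : ℝ) : ℂ) * Complex.I := by push_cast; ring
      conv_rhs => rw [norm_mul, e, Complex.norm_exp_ofReal_mul_I, mul_one, Complex.norm_real]
      rfl
    have h := tendsto_finsetSum s hterm
    rw [Finset.sum_const_zero] at h
    refine h.congr fun u => ?_
    have hFu := congrArg (fun w : ℂ => ((Real.exp (θ₀.delta * Real.sqrt (α ^ 2 + u ^ 2)) *
          Real.sqrt (α ^ 2 + u ^ 2) ^ (θ₀.lam + 1 / 2) : ℝ) : ℂ) * w) (hF u)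
    simp only [mul_zero, Finset.mul_sum] at hFu
    rw [← sub_zero (∑ θ ∈ s, ((c θ * D θ * κ θ : ℝ) : ℂ) * _), ← hFu, ← Finset.sum_sub_distrib]
    refine Finset.sum_congr rfl fun θ _ => ?_
    push_cast
    ring
  set s₀ := s.filter fun θ => θ.delta = θ₀.delta ∧ θ.lam = θ₀.lam with hs₀
  have hinj : Set.InjOn GHParam.μ (s₀ : Set GHParam) := by
    intro θ hθ θ' hθ' h
    obtain ⟨h1, h2, h3⟩ := Finset.mem_filter.1 (Finset.mem_coe.1 hθ)
    obtain ⟨h1', h2', h3'⟩ := Finset.mem_filter.1 (Finset.mem_coe.1 hθ')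
    exact GHParam.eq_of_shape (h3.trans h3'.symm)
      ((hα θ (hst θ h1)).trans (hα θ' (hst θ' h1')).symm)
      ((hb θ (hst θ h1)).trans (hb θ' (hst θ' h1')).symm) h (h2.trans h2'.symm)
  have hzero := coeff_eq_zero_of_tendsto_exp_sum s₀ GHParam.μ hinj
    (fun θ => ((c θ * D θ * κ θ : ℝ) : ℂ)) (hdiff.congr fun u =>
      (Finset.sum_filter_of_ne fun θ hθ h => by
        by_contra hne
        exact h (by rw [hκ0 θ hθ hne]; simp)).symm) θ₀
    (Finset.mem_filter.2 ⟨hθ₀, rfl, rfl⟩)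
  have hzero : c θ₀ * D θ₀ * κ θ₀ = 0 := by exact_mod_cast hzero
  exact mul_ne_zero (mul_ne_zero (Finset.mem_filter.1 hθ₀).2 (hD θ₀).ne')
    (hκ θ₀ hθ₀ ⟨rfl, rfl⟩) hzero

lemma linearIndependent_ghDensity : LinearIndependent ℝ ghDensity := by
  rw [linearIndependent_iff']
  intro t c hsum θ hθ
  have hsum' : ∀ x, ∑ θ ∈ t, c θ * ghDensity θ x = 0 := fun x => by
    simpa using congrFun hsum x
  refine coeff_eq_zero_of_common_rates (α := θ.alpha) (b := θ.tilt)
    (t.filter fun η => η.alpha - η.tilt = θ.alpha - θ.tilt ∧ η.alpha + η.tilt = θ.alpha + θ.tilt)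
    ?_ ?_ c (sum_filter_rates_eq_zero t c hsum' _ _) θ (Finset.mem_filter.2 ⟨hθ, rfl, rfl⟩)
  · intro η hη
    linarith [(Finset.mem_filter.1 hη).2.1, (Finset.mem_filter.1 hη).2.2]
  · intro η hη
    linarith [(Finset.mem_filter.1 hη).2.1, (Finset.mem_filter.1 hη).2.2]

/-- The mixing distributions are encoded as finitely supported functions on the parameter space, on
which the map to mixtures is injective; distinctness of the parameters recovers the weights. -/
lemma finiteMixturesIdentifiable_of_linearIndependent {Θ X : Type*} {f : Θ → X → ℝ}
    (hf : LinearIndependent ℝ f) : FiniteMixturesIdentifiable f := by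
  classical
  intro G G' w w' θ θ' hw hw' _ _ hθ hθ' hmix
  have hmass : ∀ {n : ℕ} (v : Fin n → ℝ) (η : Fin n → Θ), Function.Injective η → ∀ g,
      (∑ i, Finsupp.single (η i) (v i)) (η g) = v g := by
    intro n v η hη g
    rw [Finsupp.finsetSum_apply, Finset.sum_eq_single g]
    · simp
    · intro i _ hi
      exact Finsupp.single_eq_of_ne fun h => hi (hη h).symm
    · simp
  have hsupp : ∀ {n : ℕ} (v : Fin n → ℝ) (η : Fin n → Θ) (ϑ : Θ),
      (∑ i, Finsupp.single (η i) (v i)) ϑ ≠ 0 → ∃ i, η i = ϑ := by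
    intro n v η ϑ h
    by_contra! hne
    refine h ?_
    rw [Finsupp.finsetSum_apply]
    exact Finset.sum_eq_zero fun i _ => Finsupp.single_eq_of_ne fun h => hne i h.symm
  have heq : ∑ i, Finsupp.single (θ i) (w i) = ∑ i, Finsupp.single (θ' i) (w' i) := by
    refine hf ?_
    simp only [map_sum, Finsupp.linearCombination_single]
    funext x
    simpa using hmix x
  have hex : ∀ g, ∃ g', θ' g' = θ g := fun g => hsupp w' θ' (θ g) (by
    rw [← heq, hmass w θ hθ]
    exact (hw g).ne')
  have hex' : ∀ g', ∃ g, θ g = θ' g' := fun g' => hsupp w θ (θ' g') (by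
    rw [heq, hmass w' θ' hθ']
    exact (hw' g').ne')
  choose e he using hex
  refine ⟨Equiv.ofBijective e ⟨fun g₁ g₂ h => hθ ?_, fun g' => ?_⟩, fun g => ⟨?_, (he g).symm⟩⟩
  · rw [← he g₁, ← he g₂, h]
  · obtain ⟨g, hg⟩ := hex' g'
    exact ⟨g, hθ' ((he g).trans hg)⟩
  · change w g = w' (e g)
    rw [← hmass w θ hθ g, heq, ← he g, hmass w' θ' hθ']

/-- Finite mixtures of univariate generalized hyperbolic distributions are identifiable. -/
theorem theorem2 : FiniteMixturesIdentifiable ghDensity := by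
  exact finiteMixturesIdentifiable_of_linearIndependent linearIndependent_ghDensity
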